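/- Let $X_1,X_2,\dots$ be independent identically distributed positive-integer-valued random variables with $p_i=\mathbf P(X_1=i)$, and suppose that $p_i=c\,i^{-1/\theta}\bigl(1+o(i^{-1/2})\bigr)$ as $i\to\infty$ for some $c>0$ and $\theta\in(0,1)$. Let $R_k$ be the number of different elements among $X_1,\dots,X_k$ and, for $0\le k\le n$, let $R'_k=R'_{k,n}$ be the number of different elements among the last $k$ of the variables $X_1,\dots,X_n$ (so $R_0=R'_0=0$). For $n\ge1$ and $t\in[0,1]$ put \[ Z_n(t)=\frac{R_{[nt]}-\mathbf E R_{[nt]}}{\sqrt{\mathbf E R_n}},\qquad Z'_n(t)=\frac{R'_{[nt]}-\mathbf E R_{[nt]}}{\sqrt{\mathbf E R_n}} . \] Let $\overset{o}{Z}_n$ and $\overset{o}{Z'}_n$ be the functions on $[0,1]$ that are linear on each interval $[k/n,(k+1)/n]$, $0\le k\le n-1$, and satisfy, for $0\le k\le n$, \[ \overset{o}{Z}_n(k/n)=\frac{R_k-(k/n)^\theta R_n}{\sqrt{R_n}},\qquad \overset{o}{Z'}_n(k/n)=\frac{R'_k-(k/n)^\theta R_n}{\sqrt{R_n}} . \]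 Then, as $n\to\infty$, \[ \sup_{0\le t\le1}\bigl|\overset{o}{Z}_n(t)-(Z_n(t)-t^\theta Z_n(1))\bigr|\to0\ \text{ a.s.},\qquad \sup_{0\le t\le1}\bigl|\overset{o}{Z'}_n(t)-(Z'_n(t)-t^\theta Z'_n(1))\bigr|\to0\ \text{ a.s.} \] -/

import Mathlib

open MeasureTheory ProbabilityTheory Filter Asymptotics
open scoped Topology

noncomputable section

namespace UrnScheme

/-- The condition `p_i = c i^{-1/θ} (1 + o(i^{-1/2}))` as `i → ∞`, with `i` ranging over the
positive integers; the value `p 0` is not used. -/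
def PowerDecay (p : ℕ → ℝ) (c θ : ℝ) : Prop :=
  ∃ ε : ℕ → ℝ,
    (ε =o[atTop] fun i : ℕ => (i : ℝ) ^ (-(1 / 2) : ℝ)) ∧
      ∀ i : ℕ, 1 ≤ i → p i = c * (i : ℝ) ^ (-(1 / θ)) * (1 + ε i)

variable {Ω : Type*}

/-- The number of different elements among the first `k` observations. The sequence is indexed
from `0`: `X i` is the `(i+1)`-st observation. -/
def fwd (X : ℕ → Ω → ℕ) (k : ℕ) (ω : Ω) : ℕ :=
  ((Finset.range k).image fun i => X i ω).card

/-- The number of different elements among the last `k` of the first `n` observations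
(used for `k ≤ n` only). -/
def bwd (X : ℕ → Ω → ℕ) (n k : ℕ) (ω : Ω) : ℕ :=
  ((Finset.Ico (n - k) n).image fun i => X i ω).card

/-- The expectation of the number of different elements among the first `k` observations. -/
def meanFwd [MeasurableSpace Ω] (μ : Measure Ω) (X : ℕ → Ω → ℕ) (k : ℕ) : ℝ :=
  ∫ ω, (fwd X k ω : ℝ) ∂μ

/-- The forward process `Z_n(t) = (R_{[nt]} - E R_{[nt]}) / √(E R_n)`. -/
def Z [MeasurableSpace Ω] (μ : Measure Ω) (X : ℕ → Ω → ℕ) (n : ℕ) (t : ℝ) (ω : Ω) : ℝ :=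
  ((fwd X ⌊(n : ℝ) * t⌋₊ ω : ℝ) - meanFwd μ X ⌊(n : ℝ) * t⌋₊) / √(meanFwd μ X n)

/-- The backward process `Z'_n(t) = (R'_{[nt]} - E R_{[nt]}) / √(E R_n)`. -/
def Z' [MeasurableSpace Ω] (μ : Measure Ω) (X : ℕ → Ω → ℕ) (n : ℕ) (t : ℝ) (ω : Ω) : ℝ :=
  ((bwd X n ⌊(n : ℝ) * t⌋₊ ω : ℝ) - meanFwd μ X ⌊(n : ℝ) * t⌋₊) / √(meanFwd μ X n)

/-- The values `(R_k - (k/n)^θ R_n) / √R_n` of the forward empirical bridge at `k/n`. -/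
def bridgeNode (X : ℕ → Ω → ℕ) (θ : ℝ) (n k : ℕ) (ω : Ω) : ℝ :=
  ((fwd X k ω : ℝ) - ((k : ℝ) / n) ^ θ * (fwd X n ω : ℝ)) / √(fwd X n ω : ℝ)

/-- The values `(R'_k - (k/n)^θ R_n) / √R_n` of the backward empirical bridge at `k/n`. -/
def bridgeNode' (X : ℕ → Ω → ℕ) (θ : ℝ) (n k : ℕ) (ω : Ω) : ℝ :=
  ((bwd X n k ω : ℝ) - ((k : ℝ) / n) ^ θ * (fwd X n ω : ℝ)) / √(fwd X n ω : ℝ)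

/-- The piecewise linear function on `[0,1]` with value `v k` at `k/n`: with `k = [nt]` and
`u = t - k/n` its value at `t` is `v k + n u (v (k+1) - v k)`. At `t = 1` this is `v n`. -/
def interpolate (n : ℕ) (v : ℕ → ℝ) (t : ℝ) : ℝ :=
  v ⌊(n : ℝ) * t⌋₊ +
    (n : ℝ) * (t - (⌊(n : ℝ) * t⌋₊ : ℝ) / n) *
      (v (⌊(n : ℝ) * t⌋₊ + 1) - v ⌊(n : ℝ) * t⌋₊)

/-- The forward empirical bridge, a piecewise linear process on `[0,1]`. -/
def bridge (X : ℕ → Ω → ℕ) (θ : ℝ) (n : ℕ) (t : ℝ) (ω : Ω) : ℝ :=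
  interpolate n (fun k => bridgeNode X θ n k ω) t

/-- The backward empirical bridge, a piecewise linear process on `[0,1]`. -/
def bridge' (X : ℕ → Ω → ℕ) (θ : ℝ) (n : ℕ) (t : ℝ) (ω : Ω) : ℝ :=
  interpolate n (fun k => bridgeNode' X θ n k ω) t

end UrnScheme

end

/-!
Write `R_k` for the number of distinct values among `k` draws, `M_k` for its mean and `ν` for the
law of one draw.

*Concentration.* Expose the draws one at a time. The Doob martingale of `R_k` has increments
`d - E d`, where `d ∈ [0, 1]` is the probability that the drawn value is new and is missed by all
later draws. Bounding the conditional mean of `d` by the probability `missProb ν m` that a draw is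
missed by `m` further ones makes the bound deterministic, and `∑_{m < k} missProb ν m = M_k`. Hence
`E exp (s R_k) ≤ exp ((s + s²) M_k)` for `|s| ≤ 1` (`integral_exp_fwd_le`), so `R` deviates from its
mean by more than `4 log n √M_n` on a given window inside the first `n` draws with probability
`O(n⁻⁴)`. A union bound over the `O(n)` initial and final windows and the Borel–Cantelli lemma give
`ae_eventually_window_deviation_le`; the two time directions are treated alike because a final
window is an initial window of a shifted sequence.

*Regularity of the mean.* `M_n = ∑ i, (1 - (1 - p_i)^n)`. Replacing `(1 - p_i)^n` by `exp (-n p_i)`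
costs at most `∑ p_i = 1`. Replacing `p_i` by `c i^(-1/θ)` costs
`o(1) ∑ i, i^(-1/2) min(1, n c i^(-1/θ)) = o(n^(θ/2))`, which is where the rate `o(i^(-1/2))` is
used. What remains is a Riemann sum at scale `n^θ` of a decreasing function with values in
`[0, 1]`, so `M_n = C n^θ + o(n^(θ/2))` (`meanDistinct_asymptotic`).

*Comparison.* The bridges differ at the nodes by the change of normalisation, of order
`(log n)² / √M_n`, and by `(M_k - (k/n)^θ M_n) / √M_n`, which tends to `0` uniformly by the
regularity of the mean; between the nodes the further differences are of order `n^(-θ/2)` and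
`n^(-θ) log n` (`abs_bridge_sub_le`).
-/

namespace UrnScheme

/-! ### The exponential moments of the number of distinct values -/

/-- The expected number of elements of `B` that `m` further draws from `ν` all miss. -/
noncomputable def missWeight (ν : Measure ℕ) (m : ℕ) (B : Finset ℕ) : ℝ :=
  ∑ x ∈ B, (1 - ν.real {x}) ^ m

/-- The probability that a draw from `ν` is missed by `m` further independent draws. -/
noncomputable def missProb (ν : Measure ℕ) (m : ℕ) : ℝ :=
  ∫ x, (1 - ν.real {x}) ^ m ∂ν

/-- The increment of `missWeight ν m` when `x` is added to `B`: it vanishes if `x` is already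
in `B`. -/
noncomputable def missGain (ν : Measure ℕ) (m : ℕ) (B : Finset ℕ) (x : ℕ) : ℝ :=
  if x ∈ B then 0 else (1 - ν.real {x}) ^ m

/-- The mean number of distinct values among `n` independent draws from `ν`. -/
noncomputable def meanDistinct (ν : Measure ℕ) (n : ℕ) : ℝ :=
  ∑ m ∈ Finset.range n, missProb ν m

lemma missWeight_insert (ν : Measure ℕ) (m : ℕ) (B : Finset ℕ) (x : ℕ) :
    missWeight ν m (insert x B) = missWeight ν m B + missGain ν m B x := by
  unfold missWeight missGain
  split_ifs with h
  · rw [Finset.insert_eq_of_mem h, add_zero]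
  · rw [Finset.sum_insert h, add_comm]

lemma one_sub_real_le_one (ν : Measure ℕ) (x : ℕ) : 1 - ν.real {x} ≤ 1 := by
  linarith [measureReal_nonneg (μ := ν) (s := {x})]

lemma missWeight_zero (ν : Measure ℕ) (B : Finset ℕ) : missWeight ν 0 B = B.card := by
  simp [missWeight]

section OneStep

variable (ν : Measure ℕ) [IsProbabilityMeasure ν]

lemma one_sub_real_nonneg (x : ℕ) : 0 ≤ 1 - ν.real {x} := by
  linarith [measureReal_le_one (μ := ν) (s := {x})]

lemma miss_pow_nonneg (m x : ℕ) : 0 ≤ (1 - ν.real {x}) ^ m :=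
  pow_nonneg (one_sub_real_nonneg ν x) m

lemma miss_pow_le_one (m x : ℕ) : (1 - ν.real {x}) ^ m ≤ 1 :=
  pow_le_one₀ (one_sub_real_nonneg ν x) (one_sub_real_le_one ν x)

lemma missGain_nonneg (m : ℕ) (B : Finset ℕ) (x : ℕ) : 0 ≤ missGain ν m B x := by
  unfold missGain; split_ifs
  · exact le_rfl
  · exact miss_pow_nonneg ν m x

lemma missGain_le (m : ℕ) (B : Finset ℕ) (x : ℕ) :
    missGain ν m B x ≤ (1 - ν.real {x}) ^ m := by
  unfold missGain; split_ifs
  · exact miss_pow_nonneg ν m x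
  · exact le_rfl

lemma integrable_of_mem_Icc (f : ℕ → ℝ) (h0 : ∀ x, 0 ≤ f x) (h1 : ∀ x, f x ≤ 1) :
    Integrable f ν :=
  Integrable.of_bound (by fun_prop) 1 (ae_of_all _ fun x => by
    rw [Real.norm_eq_abs, abs_of_nonneg (h0 x)]; exact h1 x)

lemma missProb_nonneg (m : ℕ) : 0 ≤ missProb ν m :=
  integral_nonneg fun x => miss_pow_nonneg ν m x

lemma integral_missGain (m : ℕ) (B : Finset ℕ) :
    missWeight ν m B + ∫ x, missGain ν m B x ∂ν = missWeight ν (m + 1) B + missProb ν m := by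
  have hsplit : ∀ x, missGain ν m B x = (1 - ν.real {x}) ^ m -
      ∑ y ∈ B, ({y} : Set ℕ).indicator (fun _ => (1 - ν.real {y}) ^ m) x := by
    intro x
    have : ∑ y ∈ B, ({y} : Set ℕ).indicator (fun _ => (1 - ν.real {y}) ^ m) x =
        if x ∈ B then (1 - ν.real {x}) ^ m else 0 := by
      simp [Set.indicator_apply]
    rw [this, missGain]
    split_ifs <;> simp
  have hi : Integrable (fun x => (1 - ν.real {x}) ^ m) ν :=
    integrable_of_mem_Icc ν _ (miss_pow_nonneg ν m) (miss_pow_le_one ν m)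
  have hj : ∀ y ∈ B, Integrable
      (fun x => ({y} : Set ℕ).indicator (fun _ => (1 - ν.real {y}) ^ m) x) ν := fun y _ =>
    (integrable_const _).indicator (measurableSet_singleton y)
  simp_rw [hsplit]
  rw [integral_sub hi (integrable_finsetSum _ hj), integral_finsetSum _ hj]
  simp_rw [integral_indicator_const _ (measurableSet_singleton _), smul_eq_mul]
  have : missWeight ν (m + 1) B =
      missWeight ν m B - ∑ y ∈ B, ν.real {y} * (1 - ν.real {y}) ^ m := by
    unfold missWeight
    rw [← Finset.sum_sub_distrib]
    exact Finset.sum_congr rfl fun y _ => by ring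
  rw [this, missProb]
  ring

lemma integral_missGain_le (m : ℕ) (B : Finset ℕ) :
    ∫ x, missGain ν m B x ∂ν ≤ missProb ν m :=
  integral_mono
    (integrable_of_mem_Icc ν _ (missGain_nonneg ν m B)
      fun x => (missGain_le ν m B x).trans (miss_pow_le_one ν m x))
    (integrable_of_mem_Icc ν _ (miss_pow_nonneg ν m) (miss_pow_le_one ν m))
    (missGain_le ν m B)

/-- A variable with values in `[0, 1]` and mean `a` has exponential moment at most
`exp (s a + s² a)`: its second moment is at most `a`. -/
lemma integral_exp_le_of_mem_Icc (f : ℕ → ℝ) (h0 : ∀ x, 0 ≤ f x) (h1 : ∀ x, f x ≤ 1)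
    {s : ℝ} (hs : |s| ≤ 1) :
    ∫ x, Real.exp (s * f x) ∂ν ≤ Real.exp ((s + s ^ 2) * ∫ x, f x ∂ν) := by
  have hi := integrable_of_mem_Icc ν f h0 h1
  calc ∫ x, Real.exp (s * f x) ∂ν ≤ ∫ x, (1 + (s + s ^ 2) * f x) ∂ν := by
        refine integral_mono_of_nonneg (ae_of_all _ fun x => (Real.exp_pos _).le)
          ((integrable_const 1).add (hi.const_mul _)) (ae_of_all _ fun x => ?_)
        have hx : |s * f x| ≤ 1 := by
          rw [abs_mul, abs_of_nonneg (h0 x)]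
          exact mul_le_one₀ hs (h0 x) (h1 x)
        have h := Real.abs_exp_sub_one_sub_id_le hx
        have h2 : (s * f x) ^ 2 ≤ s ^ 2 * f x := by
          rw [mul_pow]
          refine mul_le_mul_of_nonneg_left ?_ (sq_nonneg s)
          nlinarith [h0 x, h1 x]
        have h3 := (abs_le.1 h).2
        show Real.exp (s * f x) ≤ 1 + (s + s ^ 2) * f x
        linarith
    _ = 1 + (s + s ^ 2) * ∫ x, f x ∂ν := by
        rw [integral_add (integrable_const 1) (hi.const_mul _), integral_const_mul]
        simp
    _ ≤ Real.exp ((s + s ^ 2) * ∫ x, f x ∂ν) := by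
        linarith [Real.add_one_le_exp ((s + s ^ 2) * ∫ x, f x ∂ν)]

lemma integral_exp_missWeight_insert_le (m : ℕ) (B : Finset ℕ) {s : ℝ} (hs : |s| ≤ 1) :
    ∫ x, Real.exp (s * missWeight ν m (insert x B)) ∂ν ≤
      Real.exp (s * missWeight ν (m + 1) B) * Real.exp ((s + s ^ 2) * missProb ν m) := by
  simp_rw [missWeight_insert, mul_add, Real.exp_add]
  rw [integral_const_mul]
  have h := integral_exp_le_of_mem_Icc ν _ (missGain_nonneg ν m B)
    (fun x => (missGain_le ν m B x).trans (miss_pow_le_one ν m x)) hs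
  refine (mul_le_mul_of_nonneg_left h (Real.exp_pos _).le).trans ?_
  rw [← Real.exp_add, ← Real.exp_add]
  refine Real.exp_le_exp.2 ?_
  have e1 := integral_missGain ν m B
  have e2 := mul_le_mul_of_nonneg_left (integral_missGain_le ν m B) (sq_nonneg s)
  have e3 : s * (missWeight ν m B + ∫ x, missGain ν m B x ∂ν) =
    s * (missWeight ν (m + 1) B + missProb ν m) := by rw [e1]
  linarith

lemma missWeight_nonneg (m : ℕ) (B : Finset ℕ) :
    0 ≤ missWeight ν m B := Finset.sum_nonneg fun x _ => miss_pow_nonneg ν m x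

lemma missWeight_le_card (m : ℕ) (B : Finset ℕ) :
    missWeight ν m B ≤ B.card := by
  refine (Finset.sum_le_card_nsmul _ _ 1 fun x _ => miss_pow_le_one ν m x).trans ?_
  simp

end OneStep

lemma exp_mul_le {s a b : ℝ} (hs : |s| ≤ 1) (h0 : 0 ≤ a) (h : a ≤ b) :
    Real.exp (s * a) ≤ Real.exp b := by
  refine Real.exp_le_exp.2 ((le_abs_self _).trans ?_)
  rw [abs_mul, abs_of_nonneg h0]
  nlinarith

section Seen

variable {Ω : Type*} {Y : ℕ → Ω → ℕ}

/-- The set of values among the first `k` observations. -/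
def seen (Y : ℕ → Ω → ℕ) (k : ℕ) (ω : Ω) : Finset ℕ :=
  (Finset.range k).image fun i => Y i ω

lemma seen_succ (Y : ℕ → Ω → ℕ) (k : ℕ) (ω : Ω) :
    seen Y (k + 1) ω = insert (Y k ω) (seen Y k ω) := by
  rw [seen, Finset.range_add_one, Finset.image_insert, seen]

lemma card_seen_le (Y : ℕ → Ω → ℕ) (k : ℕ) (ω : Ω) : (seen Y k ω).card ≤ k :=
  Finset.card_image_le.trans (by simp)

lemma missWeight_seen_le (ν : Measure ℕ) [IsProbabilityMeasure ν] (m j : ℕ) (ω : Ω) :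
    missWeight ν m (seen Y j ω) ≤ j :=
  (missWeight_le_card ν m _).trans (by exact_mod_cast card_seen_le Y j ω)

lemma missWeight_insert_seen_le (ν : Measure ℕ) [IsProbabilityMeasure ν] (m j x : ℕ) (ω : Ω) :
    missWeight ν m (insert x (seen Y j ω)) ≤ j + 1 :=
  (missWeight_le_card ν m _).trans (by
    exact_mod_cast (Finset.card_insert_le _ _).trans (by simpa using card_seen_le Y j ω))

lemma missWeight_seen_zero (ν : Measure ℕ) (m : ℕ) (ω : Ω) :
    missWeight ν m (seen Y 0 ω) = 0 := by simp [seen, missWeight]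

end Seen

section Draws

variable {Ω : Type*} [MeasurableSpace Ω] {μ : Measure Ω} [IsProbabilityMeasure μ]
  {Y : ℕ → Ω → ℕ}

/-- Fubini for the next draw, which is independent of the values seen so far. -/
lemma integral_seen_next (hm : ∀ i, Measurable (Y i)) (hind : iIndepFun Y μ) {ν : Measure ℕ}
    (hlaw : ∀ i, μ.map (Y i) = ν) (j : ℕ) (F : Finset ℕ → ℕ → ℝ) {C : ℝ}
    (hF : ∀ ω x, |F (seen Y j ω) x| ≤ C) :
    ∫ ω, F (seen Y j ω) (Y j ω) ∂μ = ∫ ω, ∫ x, F (seen Y j ω) x ∂ν ∂μ := by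
  let W : Ω → (Finset.range j → ℕ) := fun ω i => Y i ω
  let S : (Finset.range j → ℕ) → Finset ℕ := fun w => Finset.univ.image w
  have hS : ∀ ω, S (W ω) = seen Y j ω := by
    intro ω
    ext x
    simp [S, W, seen]
  have hW : Measurable W := measurable_pi_lambda _ fun i => hm i
  have hI : IndepFun W (Y j) μ := by
    have h := hind.indepFun_finset (Finset.range j) {j} (by simp) hm
    exact h.comp (φ := id) (ψ := fun v : (({j} : Finset ℕ) → ℕ) => v ⟨j, by simp⟩)
      measurable_id (measurable_pi_apply _)
  have hmap := hI.map_prod_eq_prod_map_map hW.aemeasurable (hm j).aemeasurable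
  rw [hlaw j] at hmap
  have hν : IsProbabilityMeasure ν := hlaw 0 ▸ Measure.isProbabilityMeasure_map (hm 0).aemeasurable
  have hWp : IsProbabilityMeasure (μ.map W) := Measure.isProbabilityMeasure_map hW.aemeasurable
  let G : (Finset.range j → ℕ) × ℕ → ℝ := fun z => F (S z.1) z.2
  have hG : Measurable G := .of_discrete
  have hpair : Measurable fun ω => (W ω, Y j ω) := hW.prodMk (hm j)
  have hint : Integrable G ((μ.map W).prod ν) := by
    rw [← hmap, integrable_map_measure hG.aestronglyMeasurable hpair.aemeasurable]
    refine Integrable.of_bound (hG.comp hpair).aestronglyMeasurable C (ae_of_all _ fun ω => ?_)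
    simp only [Function.comp, G, hS]
    exact hF ω _
  calc ∫ ω, F (seen Y j ω) (Y j ω) ∂μ = ∫ ω, G (W ω, Y j ω) ∂μ := by simp only [G, hS]
    _ = ∫ z, G z ∂((μ.map W).prod ν) := by
        rw [← hmap, integral_map hpair.aemeasurable hG.aestronglyMeasurable]
    _ = ∫ w, ∫ x, G (w, x) ∂ν ∂(μ.map W) := integral_prod _ hint
    _ = ∫ ω, ∫ x, G (W ω, x) ∂ν ∂μ :=
        integral_map hW.aemeasurable (Measurable.of_discrete).aestronglyMeasurable
    _ = _ := by simp only [G, hS]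

lemma measurable_seen_comp (hm : ∀ i, Measurable (Y i)) (j : ℕ) (f : Finset ℕ → ℝ) :
    Measurable fun ω => f (seen Y j ω) := by
  have hW : Measurable fun ω => fun i : Finset.range j => Y i ω :=
    measurable_pi_lambda _ fun i => hm i
  have h : Measurable fun w : Finset.range j → ℕ => f (Finset.univ.image w) := .of_discrete
  convert h.comp hW using 2 with ω
  simp only [Function.comp]
  congr 1
  ext x
  simp [seen]

lemma integrable_exp_missWeight_seen (hm : ∀ i, Measurable (Y i)) (ν : Measure ℕ)
    [IsProbabilityMeasure ν] {s : ℝ} (hs : |s| ≤ 1) (m j : ℕ) :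
    Integrable (fun ω => Real.exp (s * missWeight ν m (seen Y j ω))) μ := by
  refine Integrable.of_bound (measurable_seen_comp hm j
    fun B => Real.exp (s * missWeight ν m B)).aestronglyMeasurable (Real.exp j)
    (ae_of_all _ fun ω => ?_)
  rw [Real.norm_eq_abs, Real.abs_exp]
  exact exp_mul_le hs (missWeight_nonneg ν m _) (missWeight_seen_le ν m j ω)

lemma integrable_missWeight_seen (hm : ∀ i, Measurable (Y i)) (ν : Measure ℕ)
    [IsProbabilityMeasure ν] (m j : ℕ) :
    Integrable (fun ω => missWeight ν m (seen Y j ω)) μ := by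
  refine Integrable.of_bound (measurable_seen_comp hm j
    fun B => missWeight ν m B).aestronglyMeasurable j (ae_of_all _ fun ω => ?_)
  rw [Real.norm_eq_abs, abs_of_nonneg (missWeight_nonneg ν m _)]
  exact missWeight_seen_le ν m j ω

lemma integral_exp_missWeight_seen_succ_le (hm : ∀ i, Measurable (Y i)) (hind : iIndepFun Y μ)
    {ν : Measure ℕ} [IsProbabilityMeasure ν] (hlaw : ∀ i, μ.map (Y i) = ν)
    {s : ℝ} (hs : |s| ≤ 1) (m j : ℕ) :
    ∫ ω, Real.exp (s * missWeight ν m (seen Y (j + 1) ω)) ∂μ ≤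
      (∫ ω, Real.exp (s * missWeight ν (m + 1) (seen Y j ω)) ∂μ) *
        Real.exp ((s + s ^ 2) * missProb ν m) := by
  simp_rw [seen_succ]
  rw [integral_seen_next hm hind hlaw j
    (fun B x => Real.exp (s * missWeight ν m (insert x B))) (C := Real.exp (j + 1)) fun ω x => by
      rw [Real.abs_exp]
      exact exp_mul_le hs (missWeight_nonneg ν m _) (missWeight_insert_seen_le ν m j x ω),
    ← integral_mul_const]
  exact integral_mono_of_nonneg
    (ae_of_all _ fun ω => integral_nonneg fun x => (Real.exp_pos _).le)
    ((integrable_exp_missWeight_seen hm ν hs (m + 1) j).mul_const _)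
    (ae_of_all _ fun ω => integral_exp_missWeight_insert_le ν m _ hs)

lemma integral_missWeight_seen_succ (hm : ∀ i, Measurable (Y i)) (hind : iIndepFun Y μ)
    {ν : Measure ℕ} [IsProbabilityMeasure ν] (hlaw : ∀ i, μ.map (Y i) = ν) (m j : ℕ) :
    ∫ ω, missWeight ν m (seen Y (j + 1) ω) ∂μ =
      ∫ ω, missWeight ν (m + 1) (seen Y j ω) ∂μ + missProb ν m := by
  simp_rw [seen_succ]
  rw [integral_seen_next hm hind hlaw j
    (fun B x => missWeight ν m (insert x B)) (C := j + 1) fun ω x => by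
      rw [abs_of_nonneg (missWeight_nonneg ν m _)]
      exact missWeight_insert_seen_le ν m j x ω]
  have h : ∀ B, ∫ x, missWeight ν m (insert x B) ∂ν = missWeight ν (m + 1) B + missProb ν m := by
    intro B
    rw [← integral_missGain]
    simp_rw [missWeight_insert]
    rw [integral_add (integrable_const _) (integrable_of_mem_Icc ν _ (missGain_nonneg ν m B)
      fun x => (missGain_le ν m B x).trans (miss_pow_le_one ν m x))]
    simp
  simp_rw [h]
  rw [integral_add (integrable_missWeight_seen hm ν (m + 1) j) (integrable_const _)]
  simp

/-- The one-step bound iterated. With `m` draws still to come after the first `j`, the expected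
final number of distinct values is `missWeight ν m (seen Y j)` up to a deterministic term, so the
bound controls the exponential moments of a Doob martingale. -/
lemma integral_exp_missWeight_seen_le (hm : ∀ i, Measurable (Y i)) (hind : iIndepFun Y μ)
    {ν : Measure ℕ} [IsProbabilityMeasure ν] (hlaw : ∀ i, μ.map (Y i) = ν)
    {s : ℝ} (hs : |s| ≤ 1) (j m : ℕ) :
    ∫ ω, Real.exp (s * missWeight ν m (seen Y j ω)) ∂μ ≤
      Real.exp ((s + s ^ 2) * ∑ l ∈ Finset.Ico m (m + j), missProb ν l) := by
  induction j generalizing m with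
  | zero => simp [missWeight_seen_zero]
  | succ j ih =>
    refine (integral_exp_missWeight_seen_succ_le hm hind hlaw hs m j).trans ?_
    refine (mul_le_mul_of_nonneg_right (ih (m + 1)) (Real.exp_pos _).le).trans ?_
    rw [← Real.exp_add, ← mul_add, Finset.sum_eq_sum_Ico_succ_bot (show m < m + (j + 1) by omega),
      show m + 1 + j = m + (j + 1) by omega, add_comm (missProb ν m)]

lemma integral_exp_fwd_le (hm : ∀ i, Measurable (Y i)) (hind : iIndepFun Y μ)
    {ν : Measure ℕ} [IsProbabilityMeasure ν] (hlaw : ∀ i, μ.map (Y i) = ν)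
    {s : ℝ} (hs : |s| ≤ 1) (k : ℕ) :
    ∫ ω, Real.exp (s * fwd Y k ω) ∂μ ≤ Real.exp ((s + s ^ 2) * meanDistinct ν k) := by
  have h := integral_exp_missWeight_seen_le hm hind hlaw hs k 0
  simp only [missWeight_zero, zero_add, ← Finset.range_eq_Ico] at h
  exact h

lemma integral_missWeight_seen (hm : ∀ i, Measurable (Y i)) (hind : iIndepFun Y μ)
    {ν : Measure ℕ} [IsProbabilityMeasure ν] (hlaw : ∀ i, μ.map (Y i) = ν) (j m : ℕ) :
    ∫ ω, missWeight ν m (seen Y j ω) ∂μ = ∑ l ∈ Finset.Ico m (m + j), missProb ν l := by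
  induction j generalizing m with
  | zero => simp [missWeight_seen_zero]
  | succ j ih =>
    rw [integral_missWeight_seen_succ hm hind hlaw, ih,
      Finset.sum_eq_sum_Ico_succ_bot (show m < m + (j + 1) by omega),
      show m + 1 + j = m + (j + 1) by omega, add_comm (missProb ν m)]

lemma meanFwd_eq (hm : ∀ i, Measurable (Y i)) (hind : iIndepFun Y μ)
    {ν : Measure ℕ} [IsProbabilityMeasure ν] (hlaw : ∀ i, μ.map (Y i) = ν) (k : ℕ) :
    meanFwd μ Y k = meanDistinct ν k := by
  have h := integral_missWeight_seen hm hind hlaw k 0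
  simp only [missWeight_zero, zero_add, ← Finset.range_eq_Ico] at h
  exact h

lemma integrable_exp_fwd (hm : ∀ i, Measurable (Y i)) (ν : Measure ℕ)
    [IsProbabilityMeasure ν] {s : ℝ} (hs : |s| ≤ 1) (k : ℕ) :
    Integrable (fun ω => Real.exp (s * fwd Y k ω)) μ := by
  have h := integrable_exp_missWeight_seen (μ := μ) hm ν hs 0 k
  simp only [missWeight_zero] at h
  exact h

/-- Chernoff bound for the number of distinct values, with variance proxy `V ≥ E R_k`. -/
lemma measureReal_fwd_deviation_le (hm : ∀ i, Measurable (Y i)) (hind : iIndepFun Y μ)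
    {ν : Measure ℕ} [IsProbabilityMeasure ν] (hlaw : ∀ i, μ.map (Y i) = ν)
    {s V : ℝ} (hs0 : 0 ≤ s) (hs : s ≤ 1) (k : ℕ) (hV : meanDistinct ν k ≤ V) (a : ℝ) :
    μ.real {ω | a < |(fwd Y k ω : ℝ) - meanDistinct ν k|} ≤
      2 * Real.exp (-s * a + s ^ 2 * V) := by
  have hs' : |s| ≤ 1 := abs_le.2 ⟨by linarith, hs⟩
  have hs'' : |-s| ≤ 1 := by rwa [abs_neg]
  have hup := measure_ge_le_exp_mul_mgf (μ := μ) (X := fun ω => (fwd Y k ω : ℝ))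
    (meanDistinct ν k + a) hs0 (integrable_exp_fwd hm ν hs' k)
  have hlo := measure_le_le_exp_mul_mgf (μ := μ) (X := fun ω => (fwd Y k ω : ℝ))
    (meanDistinct ν k - a) (neg_nonpos.2 hs0) (integrable_exp_fwd hm ν hs'' k)
  have hup2 := mul_le_mul_of_nonneg_left (integral_exp_fwd_le hm hind hlaw hs' k)
    (Real.exp_pos (-s * (meanDistinct ν k + a))).le
  have hlo2 := mul_le_mul_of_nonneg_left (integral_exp_fwd_le hm hind hlaw hs'' k)
    (Real.exp_pos (-(-s) * (meanDistinct ν k - a))).le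
  rw [← Real.exp_add] at hup2 hlo2
  have hV' := mul_le_mul_of_nonneg_left hV (sq_nonneg s)
  have hsub : {ω | a < |(fwd Y k ω : ℝ) - meanDistinct ν k|} ⊆
      {ω | meanDistinct ν k + a ≤ (fwd Y k ω : ℝ)} ∪
        {ω | (fwd Y k ω : ℝ) ≤ meanDistinct ν k - a} := by
    intro ω hω
    rcases lt_abs.1 (Set.mem_ofPred.1 hω) with h | h
    · left; simp only [Set.mem_ofPred_eq]; linarith
    · right; simp only [Set.mem_ofPred_eq]; linarith
  refine (measureReal_mono hsub).trans ((measureReal_union_le _ _).trans ?_)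
  have e1 := (hup.trans hup2).trans (Real.exp_le_exp.2
    (show _ ≤ -s * a + s ^ 2 * V by linarith))
  have e2 := (hlo.trans hlo2).trans (Real.exp_le_exp.2
    (show _ ≤ -s * a + s ^ 2 * V by linarith))
  linarith

end Draws

/-! ### Almost sure deviation bounds over windows -/

lemma missProb_zero (ν : Measure ℕ) [IsProbabilityMeasure ν] : missProb ν 0 = 1 := by
  simp [missProb]

lemma meanDistinct_mono (ν : Measure ℕ) [IsProbabilityMeasure ν] : Monotone (meanDistinct ν) :=
  fun _ _ h => Finset.sum_le_sum_of_subset_of_nonneg (Finset.range_mono h)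
    fun m _ _ => missProb_nonneg ν m

lemma one_le_meanDistinct (ν : Measure ℕ) [IsProbabilityMeasure ν] {n : ℕ} (hn : 1 ≤ n) :
    1 ≤ meanDistinct ν n := by
  refine le_trans ?_ (meanDistinct_mono ν hn)
  simp [meanDistinct, missProb_zero]

lemma bwd_eq_fwd {Ω : Type*} (X : ℕ → Ω → ℕ) {n k : ℕ} (hk : k ≤ n) (ω : Ω) :
    bwd X n k ω = fwd (fun i => X (n - k + i)) k ω := by
  unfold bwd fwd
  congr 1
  ext x
  simp only [Finset.mem_image, Finset.mem_Ico, Finset.mem_range]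
  constructor
  · rintro ⟨i, hi, rfl⟩
    exact ⟨i - (n - k), by omega, by congr 1; omega⟩
  · rintro ⟨i, hi, rfl⟩
    exact ⟨n - k + i, by omega, rfl⟩

/-- The deviation `4 log n √M_n`, with `M_n = meanDistinct ν n`. The factor `4` makes the Chernoff
bound summable after the union over all windows. -/
noncomputable def deviationBound (ν : Measure ℕ) (n : ℕ) : ℝ :=
  4 * Real.log n * √(meanDistinct ν n)

section Draws

variable {Ω : Type*} [MeasurableSpace Ω] {μ : Measure Ω} [IsProbabilityMeasure μ]
  {X : ℕ → Ω → ℕ}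

lemma measureReal_window_deviation_le (hm : ∀ i, Measurable (X i)) (hind : iIndepFun X μ)
    {ν : Measure ℕ} [IsProbabilityMeasure ν] (hlaw : ∀ i, μ.map (X i) = ν)
    {n k : ℕ} (hn : 1 ≤ n) (hk : k ≤ n) (a : ℕ) :
    μ.real {ω | deviationBound ν n < |(fwd (fun i => X (a + i)) k ω : ℝ) - meanDistinct ν k|} ≤
      2 * (Real.exp 1 * (1 / (n : ℝ) ^ 4)) := by
  have hM := one_le_meanDistinct ν hn
  have hM0 : 0 < meanDistinct ν n := by linarith
  have hs1 : 1 ≤ √(meanDistinct ν n) := Real.one_le_sqrt.2 hM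
  have hs0 : 0 < √(meanDistinct ν n) := by linarith
  have h := measureReal_fwd_deviation_le (μ := μ) (Y := fun i => X (a + i))
    (fun i => hm _) (hind.precomp (add_right_injective a)) (fun i => hlaw _)
    (inv_nonneg.2 hs0.le) (inv_le_one_of_one_le₀ hs1) k (meanDistinct_mono ν hk)
    (deviationBound ν n)
  refine h.trans (le_of_eq ?_)
  have hn0 : (0 : ℝ) < n := by exact_mod_cast hn
  have e1 : (√(meanDistinct ν n))⁻¹ ^ 2 * meanDistinct ν n = 1 := by
    rw [inv_pow, Real.sq_sqrt hM0.le, inv_mul_cancel₀ hM0.ne']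
  have e2 : -(√(meanDistinct ν n))⁻¹ * deviationBound ν n = -(4 * Real.log n) := by
    unfold deviationBound; field_simp
  have e3 : Real.exp (4 * Real.log n) = (n : ℝ) ^ 4 := by
    rw [mul_comm, Real.exp_mul, Real.exp_log hn0]
    exact_mod_cast Real.rpow_natCast (n : ℝ) 4
  rw [e1, e2, Real.exp_add, Real.exp_neg, e3]
  ring

/-- Almost surely, for all large `n`, every initial window and every final window of the first `n`
observations contains its expected number of distinct values up to `deviationBound ν n`. -/
lemma ae_eventually_window_deviation_le (hm : ∀ i, Measurable (X i)) (hind : iIndepFun X μ)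
    {ν : Measure ℕ} [IsProbabilityMeasure ν] (hlaw : ∀ i, μ.map (X i) = ν) :
    ∀ᵐ ω ∂μ, ∀ᶠ n : ℕ in atTop, ∀ k ≤ n,
      |(fwd X k ω : ℝ) - meanDistinct ν k| ≤ deviationBound ν n ∧
      |(bwd X n k ω : ℝ) - meanDistinct ν k| ≤ deviationBound ν n := by
  let D : ℕ → ℕ → ℕ → Set Ω := fun n a k =>
    {ω | deviationBound ν n < |(fwd (fun i => X (a + i)) k ω : ℝ) - meanDistinct ν k|}
  let A : ℕ → Set Ω := fun n => ⋃ k ∈ Finset.range (n + 1), (D n 0 k ∪ D n (n - k) k)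
  have hA : ∀ n : ℕ, 1 ≤ n → μ.real (A n) ≤ (8 * Real.exp 1) * (1 / (n : ℝ) ^ 3) := by
    intro n hn
    have hn0 : (0 : ℝ) < n := by exact_mod_cast hn
    have hn1 : (1 : ℝ) ≤ n := by exact_mod_cast hn
    calc μ.real (A n)
        ≤ ∑ k ∈ Finset.range (n + 1), μ.real (D n 0 k ∪ D n (n - k) k) :=
          measureReal_biUnion_finset_le _ _
      _ ≤ ∑ k ∈ Finset.range (n + 1), 4 * (Real.exp 1 * (1 / (n : ℝ) ^ 4)) := by
          refine Finset.sum_le_sum fun k hk => (measureReal_union_le _ _).trans ?_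
          have hk' : k ≤ n := by simpa [Nat.lt_succ_iff] using hk
          have h1 := measureReal_window_deviation_le hm hind hlaw hn hk' 0
          have h2 := measureReal_window_deviation_le hm hind hlaw hn hk' (n - k)
          linarith
      _ = (n + 1) * (4 * (Real.exp 1 * (1 / (n : ℝ) ^ 4))) := by simp
      _ ≤ (2 * n) * (4 * (Real.exp 1 * (1 / (n : ℝ) ^ 4))) := by
          gcongr; linarith
      _ = (8 * Real.exp 1) * (1 / (n : ℝ) ^ 3) := by field_simp; ring
  have hsum : Summable fun n => μ.real (A n) := by
    refine Summable.of_norm_bounded_eventually_nat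
      ((Real.summable_one_div_nat_pow.2 (by norm_num : 1 < 3)).mul_left (8 * Real.exp 1)) ?_
    filter_upwards [eventually_ge_atTop 1] with n hn
    rw [Real.norm_eq_abs, abs_of_nonneg measureReal_nonneg]
    exact hA n hn
  have htsum : ∑' n, μ (A n) ≠ ⊤ := by
    have h := hsum.tsum_ofReal_ne_top
    simpa only [measureReal_def, ENNReal.ofReal_toReal (measure_ne_top μ _)] using h
  filter_upwards [ae_eventually_notMem htsum] with ω hω
  filter_upwards [hω] with n hn k hk
  have hn' : ω ∉ D n 0 k ∪ D n (n - k) k := fun h =>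
    hn (Set.mem_biUnion (Finset.mem_coe.2 (Finset.mem_range.2 (Nat.lt_succ_of_le hk))) h)
  constructor
  · refine not_lt.1 fun h => hn' (Or.inl ?_)
    simpa only [D, Set.mem_ofPred_eq, zero_add] using h
  · refine not_lt.1 fun h => hn' (Or.inr ?_)
    rw [bwd_eq_fwd X hk ω] at h
    exact h

end Draws

/-! ### The mean number of distinct values under power decay -/

/-- The limiting expected density of distinct values at the rescaled index `y`. -/
noncomputable def occupancy (c β : ℝ) (y : ℝ) : ℝ := 1 - Real.exp (-(c * y ^ (-β)))

/-- The profile that dominates the effect on the mean of a relative error of order `i ^ (-1/2)`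
in the cell probabilities. -/
noncomputable def errorProfile (c β : ℝ) (y : ℝ) : ℝ := y ^ (-(1 / 2) : ℝ) * min 1 (c * y ^ (-β))

lemma integrableOn_Ioi_of_le_rpow {f : ℝ → ℝ} (hf : Measurable f) {c β : ℝ} (hβ : 1 < β)
    (h0 : ∀ y, 0 < y → 0 ≤ f y) (h1 : ∀ y, 0 < y → y ≤ 1 → f y ≤ y ^ (-(1 / 2) : ℝ))
    (h2 : ∀ y, 1 < y → f y ≤ c * y ^ (-β)) : IntegrableOn f (Set.Ioi 0) := by
  rw [← Set.Ioc_union_Ioi_eq_Ioi zero_le_one]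
  refine IntegrableOn.union ?_ ?_
  · have h : IntegrableOn (fun y : ℝ => y ^ (-(1 / 2) : ℝ)) (Set.Ioc 0 1) :=
      (intervalIntegrable_iff_integrableOn_Ioc_of_le zero_le_one).1
        (intervalIntegral.intervalIntegrable_rpow' (by norm_num))
    refine Integrable.mono' h hf.aestronglyMeasurable ?_
    filter_upwards [ae_restrict_mem measurableSet_Ioc] with y hy
    rw [Real.norm_eq_abs, abs_of_nonneg (h0 y hy.1)]
    exact h1 y hy.1 hy.2
  · have h : IntegrableOn (fun y : ℝ => c * y ^ (-β)) (Set.Ioi 1) :=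
      (integrableOn_Ioi_rpow_of_lt (by linarith) zero_lt_one).const_mul c
    refine Integrable.mono' h hf.aestronglyMeasurable ?_
    filter_upwards [ae_restrict_mem measurableSet_Ioi] with y hy
    have hy' : (1 : ℝ) < y := hy
    rw [Real.norm_eq_abs, abs_of_nonneg (h0 y (by linarith))]
    exact h2 y hy'

/-- Riemann sums of a decreasing function at scale `L`, compared with its integral. -/
lemma riemann_sum_antitone {h : ℝ → ℝ} (hanti : AntitoneOn h (Set.Ioi 0))
    (h0 : ∀ y, 0 < y → 0 ≤ h y) (hint : IntegrableOn h (Set.Ioi 0)) {L : ℝ} (hL : 0 < L) :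
    Summable (fun i : ℕ => h (L⁻¹ * ((i : ℝ) + 1))) ∧
      ∑' i : ℕ, h (L⁻¹ * ((i : ℝ) + 1)) ≤ h L⁻¹ + L * ∫ y in Set.Ioi 0, h y ∧
      L * ∫ y in Set.Ioi 0, h y ≤
        ∑' i : ℕ, h (L⁻¹ * ((i : ℝ) + 1)) + ∫ x in Set.Ioc 0 1, h (L⁻¹ * x) := by
  have hLi : 0 < L⁻¹ := inv_pos.2 hL
  let f : ℝ → ℝ := fun x => h (L⁻¹ * x)
  have hf0 : ∀ x, 0 < x → 0 ≤ f x := fun x hx => h0 _ (mul_pos hLi hx)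
  have hfanti : AntitoneOn f (Set.Ioi 0) := fun x hx y hy hxy =>
    hanti (mul_pos hLi hx) (mul_pos hLi hy) (by gcongr)
  have hfint : IntegrableOn f (Set.Ioi 0) :=
    (integrableOn_Ioi_comp_mul_left_iff h 0 hLi).2 (by simpa using hint)
  have hfI : ∫ x in Set.Ioi 0, f x = L * ∫ y in Set.Ioi 0, h y := by
    have := integral_comp_mul_left_Ioi h 0 hLi
    simpa [f] using this
  have hanti1 : AntitoneOn f (Set.Ici ((1 : ℕ) : ℝ)) :=
    hfanti.mono fun x hx => lt_of_lt_of_le zero_lt_one (by simpa using hx)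
  have hint1 : IntegrableOn f (Set.Ioi ((1 : ℕ) : ℝ)) :=
    hfint.mono_set (Set.Ioi_subset_Ioi (by simp))
  have hnn1 : ∀ t ∈ Set.Ioi ((1 : ℕ) : ℝ), 0 ≤ f t := fun t ht =>
    hf0 t (lt_trans zero_lt_one (by simpa using ht))
  have hs := hanti1.summable_of_integrableOn_Ioi hint1 hnn1
  have hup := hanti1.tsum_comp_add_le_integral 1 hint1 hnn1
  have hlo := hanti1.integral_le_tsum_comp_add 1 hs hnn1
  have hs1 : Summable fun i : ℕ => f ((i + 1 : ℕ) : ℝ) := (summable_nat_add_iff 1).2 hs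
  have hsplit : ∫ x in Set.Ioi 0, f x =
      (∫ x in Set.Ioc 0 1, f x) + ∫ x in Set.Ioi ((1 : ℕ) : ℝ), f x := by
    rw [Nat.cast_one, ← Set.Ioc_union_Ioi_eq_Ioi (zero_le_one' ℝ)]
    refine setIntegral_union (Set.Ioc_disjoint_Ioi le_rfl) measurableSet_Ioi
      (hfint.mono_set Set.Ioc_subset_Ioi_self) (hfint.mono_set (Set.Ioi_subset_Ioi zero_le_one))
  have h01 : 0 ≤ ∫ x in Set.Ioc 0 1, f x :=
    setIntegral_nonneg measurableSet_Ioc fun x hx => hf0 x hx.1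
  have hz := hs1.tsum_eq_zero_add
  have hcast : (fun i : ℕ => h (L⁻¹ * ((i : ℝ) + 1))) = fun i : ℕ => f ((i + 1 : ℕ) : ℝ) := by
    funext i; simp [f]
  have hf1 : f ((0 + 1 : ℕ) : ℝ) = h L⁻¹ := by simp [f]
  rw [hcast, ← hfI]
  refine ⟨hs1, ?_, ?_⟩
  · rw [hz, hf1]
    linarith
  · rw [hsplit]
    exact (add_comm _ _).trans_le (add_le_add_left hlo _)

section Profiles

variable {c β : ℝ}

lemma antitoneOn_mul_rpow_neg (hc : 0 < c) (hβ : 1 < β) :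
    AntitoneOn (fun y : ℝ => c * y ^ (-β)) (Set.Ioi 0) := fun x hx y _ hxy =>
  mul_le_mul_of_nonneg_left
    (Real.rpow_le_rpow_of_nonpos (Set.mem_Ioi.1 hx) hxy (by linarith)) hc.le

lemma occupancy_nonneg (hc : 0 < c) {y : ℝ} (hy : 0 < y) : 0 ≤ occupancy c β y :=
  sub_nonneg.2 (Real.exp_le_one_iff.2 (neg_nonpos.2 (by positivity)))

lemma occupancy_pos (hc : 0 < c) {y : ℝ} (hy : 0 < y) : 0 < occupancy c β y :=
  sub_pos.2 (Real.exp_lt_one_iff.2 (neg_lt_zero.2 (by positivity)))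

lemma occupancy_le_one (y : ℝ) : occupancy c β y ≤ 1 := by
  unfold occupancy; linarith [Real.exp_pos (-(c * y ^ (-β)))]

lemma occupancy_le (y : ℝ) : occupancy c β y ≤ c * y ^ (-β) := by
  unfold occupancy; linarith [Real.add_one_le_exp (-(c * y ^ (-β)))]

lemma antitoneOn_occupancy (hc : 0 < c) (hβ : 1 < β) :
    AntitoneOn (occupancy c β) (Set.Ioi 0) := fun _ hx _ hy hxy =>
  sub_le_sub_left (Real.exp_le_exp.2
    (neg_le_neg (antitoneOn_mul_rpow_neg hc hβ hx hy hxy))) 1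

lemma one_le_rpow_neg_half {y : ℝ} (hy : 0 < y) (hy1 : y ≤ 1) : 1 ≤ y ^ (-(1 / 2) : ℝ) :=
  Real.one_le_rpow_of_pos_of_le_one_of_nonpos hy hy1 (by norm_num)

lemma integrableOn_occupancy (hc : 0 < c) (hβ : 1 < β) :
    IntegrableOn (occupancy c β) (Set.Ioi 0) :=
  integrableOn_Ioi_of_le_rpow (by unfold occupancy; fun_prop) hβ
    (fun _ hy => occupancy_nonneg hc hy)
    (fun y hy hy1 => (occupancy_le_one y).trans (one_le_rpow_neg_half hy hy1))
    (fun y _ => occupancy_le y)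

lemma integral_occupancy_pos (hc : 0 < c) (hβ : 1 < β) :
    0 < ∫ y in Set.Ioi 0, occupancy c β y := by
  rw [setIntegral_pos_iff_support_of_nonneg_ae
    ((ae_restrict_mem measurableSet_Ioi).mono fun y hy => occupancy_nonneg hc hy)
    (integrableOn_occupancy hc hβ)]
  have hsub : Set.Ioi 0 ⊆ Function.support (occupancy c β) :=
    fun y hy => (occupancy_pos hc hy).ne'
  rw [Set.inter_eq_right.2 hsub]
  simp

lemma errorProfile_nonneg (hc : 0 < c) {y : ℝ} (hy : 0 < y) : 0 ≤ errorProfile c β y := by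
  unfold errorProfile; positivity

lemma errorProfile_le_rpow_neg_half {y : ℝ} (hy : 0 < y) :
    errorProfile c β y ≤ y ^ (-(1 / 2) : ℝ) :=
  mul_le_of_le_one_right (by positivity) (min_le_left _ _)

lemma antitoneOn_errorProfile (hc : 0 < c) (hβ : 1 < β) :
    AntitoneOn (errorProfile c β) (Set.Ioi 0) := fun x hx y hy hxy => by
  have hx' : 0 < x := hx
  have hy' : 0 < y := hy
  exact mul_le_mul (Real.rpow_le_rpow_of_nonpos hx' hxy (by norm_num))
    (min_le_min le_rfl (antitoneOn_mul_rpow_neg hc hβ hx hy hxy)) (by positivity) (by positivity)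

lemma integrableOn_errorProfile (hc : 0 < c) (hβ : 1 < β) :
    IntegrableOn (errorProfile c β) (Set.Ioi 0) := by
  refine integrableOn_Ioi_of_le_rpow (c := c) (by unfold errorProfile; fun_prop) hβ
    (fun _ hy => errorProfile_nonneg hc hy)
    (fun y hy _ => errorProfile_le_rpow_neg_half hy) (fun y hy => ?_)
  have hy0 : 0 < y := by linarith
  refine (mul_le_of_le_one_left (by positivity)
    (Real.rpow_le_one_of_one_le_of_nonpos hy.le (by norm_num))).trans (min_le_right _ _)

end Profiles

lemma mul_exp_neg_le_one (x : ℝ) : x * Real.exp (-x) ≤ 1 := by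
  rw [Real.exp_neg, ← div_eq_mul_inv, div_le_one (Real.exp_pos x)]
  linarith [Real.add_one_le_exp x]

/-- Comparison of binomial and Poisson probabilities of an empty cell. -/
lemma abs_pow_sub_exp_le {q : ℝ} (h0 : 0 ≤ q) (h1 : q ≤ 1) (n : ℕ) :
    |(1 - q) ^ n - Real.exp (-(n * q))| ≤ q := by
  have hle : (1 - q) ^ n ≤ Real.exp (-(n * q)) := by
    have h := pow_le_pow_left₀ (by linarith) (Real.one_sub_le_exp_neg q) n
    rwa [← Real.exp_nat_mul, mul_neg] at h
  rw [abs_sub_comm, abs_of_nonneg (sub_nonneg.2 hle)]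
  -- The ratio of the two probabilities is at least `(1 - q²)^n`, to which Bernoulli applies.
  have hb : 1 - n * q ^ 2 ≤ (1 - q) ^ n * Real.exp (n * q) := by
    have hB := one_add_mul_le_pow (show (-2 : ℝ) ≤ -q ^ 2 by nlinarith) n
    have hq : 1 + -q ^ 2 ≤ (1 - q) * Real.exp q := by
      nlinarith [mul_le_mul_of_nonneg_left (Real.add_one_le_exp q) (sub_nonneg.2 h1)]
    have hp := pow_le_pow_left₀ (by nlinarith) hq n
    rw [mul_pow, ← Real.exp_nat_mul] at hp
    linarith
  have he : Real.exp (n * q) * Real.exp (-(n * q)) = 1 := by rw [← Real.exp_add]; simp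
  have h2 := mul_le_mul_of_nonneg_right hb (Real.exp_pos (-(n * q))).le
  rw [mul_assoc, he, mul_one] at h2
  have h3 := mul_le_mul_of_nonneg_left (mul_exp_neg_le_one (n * q)) h0
  nlinarith

/-- The function `x ↦ exp (-x)` is Lipschitz with constant `exp (-a)` on `[a, ∞)`. -/
lemma abs_exp_neg_sub_le {a x y : ℝ} (hx : a ≤ x) (hy : a ≤ y) :
    |Real.exp (-x) - Real.exp (-y)| ≤ |x - y| * Real.exp (-a) := by
  wlog h : x ≤ y generalizing x y
  · rw [abs_sub_comm, abs_sub_comm x]; exact this hy hx (le_of_not_ge h)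
  rw [abs_of_nonneg (sub_nonneg.2 (Real.exp_le_exp.2 (by linarith))), abs_sub_comm,
    abs_of_nonneg (by linarith)]
  have h1 : Real.exp (-y) = Real.exp (-x) * Real.exp (-(y - x)) := by
    rw [← Real.exp_add]; congr 1; ring
  have h2 := Real.one_sub_le_exp_neg (y - x)
  have h3 : Real.exp (-x) ≤ Real.exp (-a) := Real.exp_le_exp.2 (by linarith)
  have h4 := Real.exp_pos (-x)
  rw [h1]
  nlinarith [mul_le_mul_of_nonneg_left h2 h4.le,
    mul_le_mul_of_nonneg_left h3 (show 0 ≤ y - x by linarith)]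

/-- A relative error `δ` in a cell probability with expected count `x` changes the probability
that the cell is empty by at most `δ min(1, x)`. -/
lemma abs_exp_neg_perturb_le {x δ : ℝ} (hx : 0 ≤ x) (hδ : |δ| ≤ 1 / 2) :
    |Real.exp (-(x * (1 + δ))) - Real.exp (-x)| ≤ |δ| * min 1 x := by
  have hd := abs_le.1 hδ
  refine (abs_exp_neg_sub_le (a := x / 2) (by nlinarith) (by linarith)).trans ?_
  have e : |x * (1 + δ) - x| = |δ| * x := by
    rw [show x * (1 + δ) - x = δ * x by ring, abs_mul, abs_of_nonneg hx]
  rw [e, mul_assoc]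
  refine mul_le_mul_of_nonneg_left (le_min ?_ ?_) (abs_nonneg δ)
  · have h := Real.add_one_le_exp (x / 2)
    have h2 := Real.add_one_le_exp (x / 2 - 1)
    have h3 : Real.exp (x / 2 - 1) * Real.exp 1 = Real.exp (x / 2) := by
      rw [← Real.exp_add]; congr 1; ring
    rw [Real.exp_neg, ← div_eq_mul_inv, div_le_one (Real.exp_pos _)]
    nlinarith [Real.add_one_le_exp (1 : ℝ)]
  · exact mul_le_of_le_one_right hx (Real.exp_le_one_iff.2 (by linarith))

section Mean

variable (ν : Measure ℕ) [IsProbabilityMeasure ν]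

lemma summable_measureReal_singleton : Summable fun i : ℕ => ν.real {i} := by
  have h : ∑' i : ℕ, ν {i} ≠ ⊤ := by
    have := (measure_iUnion (μ := ν) (f := fun i : ℕ => ({i} : Set ℕ))
      (fun i j hij => by simpa using hij) fun i => measurableSet_singleton i)
    rw [← this]
    exact measure_ne_top _ _
  exact ENNReal.summable_toReal h

lemma tsum_measureReal_singleton : ∑' i : ℕ, ν.real {i} = 1 := by
  have h := integral_countable (μ := ν) (integrable_const (1 : ℝ))
  simpa using h.symm

lemma one_sub_pow_le_mul {q : ℝ} (h1 : q ≤ 1) (n : ℕ) : 1 - (1 - q) ^ n ≤ n * q := by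
  have h := one_add_mul_le_pow (show (-2 : ℝ) ≤ -q by linarith) n
  rw [← sub_eq_add_neg] at h
  linarith

lemma summable_hit (n : ℕ) : Summable fun i : ℕ => 1 - (1 - ν.real {i}) ^ n :=
  Summable.of_nonneg_of_le (fun _ => sub_nonneg.2 (miss_pow_le_one ν n _))
    (fun _ => one_sub_pow_le_mul measureReal_le_one n)
    ((summable_measureReal_singleton ν).mul_left (n : ℝ))

lemma meanDistinct_eq_tsum (n : ℕ) :
    meanDistinct ν n = ∑' i : ℕ, (1 - (1 - ν.real {i}) ^ n) := by
  have hi : ∀ m ∈ Finset.range n, Integrable (fun x => (1 - ν.real {x}) ^ m) ν := fun m _ =>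
    integrable_of_mem_Icc ν _ (miss_pow_nonneg ν m) (miss_pow_le_one ν m)
  unfold meanDistinct missProb
  rw [← integral_finsetSum _ hi, integral_countable (integrable_finsetSum _ hi)]
  refine tsum_congr fun i => ?_
  rw [smul_eq_mul, ← geom_sum_mul_neg]
  ring

end Mean

lemma mul_rpow_scale {c θ : ℝ} (hθ0 : 0 < θ) {n : ℕ} (hn : 1 ≤ n) {y : ℝ} (hy : 0 ≤ y) :
    c * (((n : ℝ) ^ θ)⁻¹ * y) ^ (-(1 / θ)) = n * (c * y ^ (-(1 / θ))) := by
  have hn0 : (0 : ℝ) < n := by exact_mod_cast hn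
  rw [Real.mul_rpow (by positivity) hy, ← Real.rpow_neg hn0.le, ← Real.rpow_mul hn0.le]
  have : -θ * -(1 / θ) = 1 := by field_simp
  rw [this, Real.rpow_one]
  ring

lemma errorProfile_scale {c θ : ℝ} (hθ0 : 0 < θ) {n : ℕ} (hn : 1 ≤ n) {y : ℝ} (hy : 0 ≤ y) :
    errorProfile c (1 / θ) (((n : ℝ) ^ θ)⁻¹ * y) =
      (n : ℝ) ^ (θ / 2) * (y ^ (-(1 / 2) : ℝ) * min 1 (n * (c * y ^ (-(1 / θ))))) := by
  have hn0 : (0 : ℝ) < n := by exact_mod_cast hn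
  rw [errorProfile, mul_rpow_scale hθ0 hn hy, Real.mul_rpow (by positivity) hy,
    ← Real.rpow_neg hn0.le, ← Real.rpow_mul hn0.le, show -θ * -(1 / 2) = θ / 2 by ring]
  ring

/-- For power-law cell probabilities with relative error `o(i ^ (-1/2))`, the mean number of
distinct values is a multiple of `n ^ θ` up to `o(n ^ (θ / 2))`. -/
theorem meanDistinct_asymptotic {ν : Measure ℕ} [IsProbabilityMeasure ν] (hν0 : ν.real {0} = 0)
    {c θ : ℝ} (hc : 0 < c) (hθ0 : 0 < θ) (hθ1 : θ < 1)
    (hp : PowerDecay (fun i => ν.real {i}) c θ) :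
    ∃ C : ℝ, 0 < C ∧ (fun n : ℕ => meanDistinct ν n - C * (n : ℝ) ^ θ) =o[atTop]
      fun n : ℕ => (n : ℝ) ^ (θ / 2) := by
  have hβ : 1 < 1 / θ := by rw [lt_div_iff₀ hθ0]; linarith
  obtain ⟨ε, hε, hq⟩ := hp
  refine ⟨∫ y in Set.Ioi 0, occupancy c (1 / θ) y, integral_occupancy_pos hc hβ, ?_⟩
  set C := ∫ y in Set.Ioi 0, occupancy c (1 / θ) y
  set K := ∫ y in Set.Ioi 0, errorProfile c (1 / θ) y
  have hK : 0 ≤ K := setIntegral_nonneg measurableSet_Ioi fun y hy => errorProfile_nonneg hc hy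
  -- The sum of the limiting empty-cell probabilities, as a Riemann sum.
  have hmain : ∀ n : ℕ, 1 ≤ n →
      Summable (fun i : ℕ => occupancy c (1 / θ) (((n : ℝ) ^ θ)⁻¹ * ((i : ℝ) + 1))) ∧
      |∑' i : ℕ, occupancy c (1 / θ) (((n : ℝ) ^ θ)⁻¹ * ((i : ℝ) + 1)) - C * (n : ℝ) ^ θ|
        ≤ 1 := by
    intro n hn
    have hn0 : (0 : ℝ) < n := by exact_mod_cast hn
    obtain ⟨hs, hu, hl⟩ := riemann_sum_antitone (antitoneOn_occupancy hc hβ)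
      (fun y hy => occupancy_nonneg hc hy) (integrableOn_occupancy hc hβ)
      (show 0 < (n : ℝ) ^ θ by positivity)
    refine ⟨hs, abs_le.2 ⟨?_, ?_⟩⟩
    · have h1 : ∫ x in Set.Ioc 0 1, occupancy c (1 / θ) (((n : ℝ) ^ θ)⁻¹ * x) ≤ 1 := by
        have := setIntegral_mono_on (μ := volume) (s := Set.Ioc (0 : ℝ) 1)
          (f := fun x => occupancy c (1 / θ) (((n : ℝ) ^ θ)⁻¹ * x)) (g := fun _ => (1 : ℝ))
          (((integrableOn_Ioi_comp_mul_left_iff (occupancy c (1 / θ)) 0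
            (show 0 < ((n : ℝ) ^ θ)⁻¹ by positivity)).2
            (by simpa using integrableOn_occupancy hc hβ)).mono_set Set.Ioc_subset_Ioi_self)
          (by simp) measurableSet_Ioc (fun x _ => occupancy_le_one _)
        simpa using this
      linarith
    · have := occupancy_le_one (c := c) (β := 1 / θ) ((n : ℝ) ^ θ)⁻¹
      linarith
  have herr : ∀ n : ℕ, 1 ≤ n →
      Summable (fun i : ℕ => ((i : ℝ) + 1) ^ (-(1 / 2) : ℝ) *
        min 1 (n * (c * ((i : ℝ) + 1) ^ (-(1 / θ))))) ∧
      ∑' i : ℕ, ((i : ℝ) + 1) ^ (-(1 / 2) : ℝ) * min 1 (n * (c * ((i : ℝ) + 1) ^ (-(1 / θ))))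
        ≤ (1 + K) * (n : ℝ) ^ (θ / 2) := by
    intro n hn
    have hn1 : (1 : ℝ) ≤ n := by exact_mod_cast hn
    have hn0 : (0 : ℝ) < n := by linarith
    obtain ⟨hs, hu, -⟩ := riemann_sum_antitone (antitoneOn_errorProfile hc hβ)
      (fun y hy => errorProfile_nonneg hc hy) (integrableOn_errorProfile hc hβ)
      (show 0 < (n : ℝ) ^ θ by positivity)
    have hsc : ∀ i : ℕ, errorProfile c (1 / θ) (((n : ℝ) ^ θ)⁻¹ * ((i : ℝ) + 1)) = _ := fun i =>
      errorProfile_scale hθ0 hn (by positivity : (0 : ℝ) ≤ (i : ℝ) + 1)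
    simp_rw [hsc] at hs hu
    have hpos : (0 : ℝ) < (n : ℝ) ^ (θ / 2) := by positivity
    refine ⟨(summable_mul_left_iff hpos.ne').1 hs, ?_⟩
    rw [tsum_mul_left] at hu
    have hsq : (n : ℝ) ^ θ = (n : ℝ) ^ (θ / 2) * (n : ℝ) ^ (θ / 2) := by
      rw [← Real.rpow_add hn0]; congr 1; ring
    have h1 : errorProfile c (1 / θ) ((n : ℝ) ^ θ)⁻¹ ≤ (n : ℝ) ^ θ := by
      refine (errorProfile_le_rpow_neg_half (by positivity)).trans ?_
      rw [← Real.rpow_neg hn0.le, ← Real.rpow_mul hn0.le]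
      exact Real.rpow_le_rpow_of_exponent_le hn1 (by linarith)
    have h2 := hu.trans (add_le_add_left h1 _)
    rw [hsq] at h2
    refine le_of_mul_le_mul_left (h2.trans (le_of_eq ?_)) hpos
    ring
  rw [isLittleO_iff]
  intro r hr
  set η := r / (2 * (1 + K))
  have hη : 0 < η := by positivity
  obtain ⟨I, hI⟩ : ∃ I : ℕ, ∀ i : ℕ, I ≤ i →
      |ε i| ≤ η * (i : ℝ) ^ (-(1 / 2) : ℝ) ∧ |ε i| ≤ 1 / 2 := by
    have hhalf : Tendsto (fun i : ℕ => (i : ℝ) ^ (-(1 / 2) : ℝ)) atTop (𝓝 0) :=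
      (tendsto_rpow_neg_atTop (by norm_num : (0 : ℝ) < 1 / 2)).comp tendsto_natCast_atTop_atTop
    have h0 : Tendsto ε atTop (𝓝 0) := hε.trans_tendsto hhalf
    have e1 := (isLittleO_iff.1 hε) hη
    have e2 := (h0.abs).eventually (Iic_mem_nhds (by simp : |(0 : ℝ)| < 1 / 2))
    obtain ⟨I, hI⟩ := eventually_atTop.1 (e1.and e2)
    refine ⟨I, fun i hi => ⟨?_, (hI i hi).2⟩⟩
    have := (hI i hi).1
    rwa [Real.norm_eq_abs, Real.norm_eq_abs,
      abs_of_nonneg (show (0 : ℝ) ≤ (i : ℝ) ^ (-(1 / 2) : ℝ) by positivity)] at this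
  have hgrow : Tendsto (fun n : ℕ => r / 2 * (n : ℝ) ^ (θ / 2)) atTop atTop :=
    ((tendsto_rpow_atTop (by linarith : 0 < θ / 2)).comp
      tendsto_natCast_atTop_atTop).const_mul_atTop (by positivity)
  filter_upwards [eventually_ge_atTop 1, hgrow.eventually_ge_atTop (2 + I)] with n hn hbig
  have hn0 : (0 : ℝ) < n := by exact_mod_cast hn
  obtain ⟨hs1, hm1⟩ := hmain n hn
  obtain ⟨hs2, hm2⟩ := herr n hn
  have hqs := (summable_nat_add_iff 1).2 (summable_measureReal_singleton ν)
  have hq1 : ∑' i : ℕ, ν.real {i + 1} ≤ 1 := by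
    have := (summable_measureReal_singleton ν).tsum_eq_zero_add
    rw [tsum_measureReal_singleton, hν0] at this
    linarith
  have hhs := (summable_nat_add_iff 1).2 (summable_hit ν n)
  have hM : meanDistinct ν n = ∑' i : ℕ, (1 - (1 - ν.real {i + 1}) ^ n) := by
    rw [meanDistinct_eq_tsum, (summable_hit ν n).tsum_eq_zero_add, hν0]
    simp
  -- The first `I` cells, where the relative error is not controlled, are counted in full.
  have hfin : HasSum (fun i : ℕ => if i < I then (1 : ℝ) else 0) I := by
    have h : HasSum (fun i : ℕ => if i < I then (1 : ℝ) else 0)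
        (∑ i ∈ Finset.range I, if i < I then (1 : ℝ) else 0) :=
      hasSum_sum_of_ne_finset_zero fun i hi => if_neg (by simpa using hi)
    rwa [Finset.sum_congr rfl fun i hi => if_pos (Finset.mem_range.1 hi), Finset.sum_const,
      Finset.card_range, nsmul_one] at h
  have hterm : ∀ i : ℕ, ‖(1 - (1 - ν.real {i + 1}) ^ n) -
      occupancy c (1 / θ) (((n : ℝ) ^ θ)⁻¹ * ((i : ℝ) + 1))‖ ≤
      ν.real {i + 1} + (if i < I then (1 : ℝ) else 0) +
        η * (((i : ℝ) + 1) ^ (-(1 / 2) : ℝ) * min 1 (n * (c * ((i : ℝ) + 1) ^ (-(1 / θ))))) := by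
    intro i
    have hi0 : (0 : ℝ) < (i : ℝ) + 1 := by positivity
    have hx0 : 0 ≤ n * (c * ((i : ℝ) + 1) ^ (-(1 / θ))) := by positivity
    have hqi : ν.real {i + 1} = c * ((i : ℝ) + 1) ^ (-(1 / θ)) * (1 + ε (i + 1)) := by
      have := hq (i + 1) (by omega)
      simpa using this
    have hA := abs_pow_sub_exp_le (measureReal_nonneg (μ := ν) (s := {i + 1}))
      measureReal_le_one n
    rw [occupancy, mul_rpow_scale hθ0 hn hi0.le, Real.norm_eq_abs]
    have hB : |Real.exp (-(n * ν.real {i + 1})) -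
        Real.exp (-(n * (c * ((i : ℝ) + 1) ^ (-(1 / θ)))))| ≤ (if i < I then (1 : ℝ) else 0) +
        η * (((i : ℝ) + 1) ^ (-(1 / 2) : ℝ) * min 1 (n * (c * ((i : ℝ) + 1) ^ (-(1 / θ))))) := by
      split_ifs with hiI
      · have a1 := Real.exp_pos (-(n * ν.real {i + 1}))
        have a2 : Real.exp (-(n * ν.real {i + 1})) ≤ 1 := Real.exp_le_one_iff.2 (neg_nonpos.2
          (mul_nonneg hn0.le measureReal_nonneg))
        have a3 := Real.exp_pos (-(n * (c * ((i : ℝ) + 1) ^ (-(1 / θ)))))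
        have a4 : Real.exp (-(n * (c * ((i : ℝ) + 1) ^ (-(1 / θ))))) ≤ 1 :=
          Real.exp_le_one_iff.2 (neg_nonpos.2 hx0)
        have a5 : 0 ≤ η * (((i : ℝ) + 1) ^ (-(1 / 2) : ℝ) *
          min 1 (n * (c * ((i : ℝ) + 1) ^ (-(1 / θ))))) := by positivity
        refine (abs_le.2 ⟨?_, ?_⟩ : _ ≤ (1 : ℝ)).trans (by linarith) <;> linarith
      · obtain ⟨b1, b2⟩ := hI (i + 1) (by omega)
        have h := abs_exp_neg_perturb_le hx0 b2
        rw [show n * (c * ((i : ℝ) + 1) ^ (-(1 / θ))) * (1 + ε (i + 1)) =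
          n * ν.real {i + 1} by rw [hqi]; ring] at h
        push_cast at b1
        refine h.trans ?_
        rw [zero_add, ← mul_assoc η]
        exact mul_le_mul_of_nonneg_right b1 (le_min zero_le_one hx0)
    rw [show (1 - (1 - ν.real {i + 1}) ^ n) -
        (1 - Real.exp (-(n * (c * ((i : ℝ) + 1) ^ (-(1 / θ)))))) =
        -((1 - ν.real {i + 1}) ^ n - Real.exp (-(n * ν.real {i + 1}))) -
        (Real.exp (-(n * ν.real {i + 1})) -
          Real.exp (-(n * (c * ((i : ℝ) + 1) ^ (-(1 / θ)))))) by ring]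
    refine (abs_sub _ _).trans ?_
    rw [abs_neg]
    linarith
  have hbs := (hqs.hasSum.add hfin).add (hs2.hasSum.mul_left η)
  have hdiff := tsum_of_norm_bounded hbs hterm
  rw [hhs.tsum_sub hs1, ← hM, Real.norm_eq_abs] at hdiff
  rw [Real.norm_eq_abs, Real.norm_eq_abs,
    abs_of_nonneg (show (0 : ℝ) ≤ (n : ℝ) ^ (θ / 2) by positivity)]
  have hηK : η * ((1 + K) * (n : ℝ) ^ (θ / 2)) = r / 2 * (n : ℝ) ^ (θ / 2) := by
    simp only [η]; field_simp
  have h3 := mul_le_mul_of_nonneg_left hm2 hη.le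
  rw [hηK] at h3
  have h4 := abs_sub_le (meanDistinct ν n)
    (∑' i : ℕ, occupancy c (1 / θ) (((n : ℝ) ^ θ)⁻¹ * ((i : ℝ) + 1))) (C * (n : ℝ) ^ θ)
  linarith

/-! ### Comparison of the bridges -/

lemma abs_rpow_sub_rpow_le {θ x y w : ℝ} (hθ0 : 0 < θ) (hθ1 : θ < 1) (hx : 0 ≤ x) (hxy : x ≤ y)
    (hw : y ≤ x + w) : |y ^ θ - x ^ θ| ≤ w ^ θ := by
  have hw0 : 0 ≤ w := by linarith
  have h1 : x ^ θ ≤ y ^ θ := Real.rpow_le_rpow hx hxy hθ0.le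
  have h2 : y ^ θ ≤ (x + w) ^ θ := Real.rpow_le_rpow (hx.trans hxy) hw hθ0.le
  have h3 := Real.rpow_add_le_add_rpow hx hw0 hθ0.le hθ1.le
  rw [abs_of_nonneg (by linarith)]
  linarith

/-- Deterministic comparison of the two bridges built from a path `r` with steps at most `1`, close
to `M`, when `M` is close to a multiple of `k ^ θ`. The first summand is the effect of normalising
by `√(r n)` in place of `√(M n)`, the second that of centring, the next two come from the linear
interpolation and the last from replacing `(⌊n t⌋ / n) ^ θ` by `t ^ θ`. -/
lemma abs_bridge_sub_le {θ : ℝ} (hθ0 : 0 < θ) (hθ1 : θ < 1) {n : ℕ} (hn : 1 ≤ n) {r M : ℕ → ℝ}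
    {L d : ℝ} (hL : 0 ≤ L) (hd : 0 ≤ d) (hM : 0 < M n) (hLM : L ≤ 3 / 4 * √(M n))
    (hdev : ∀ k ≤ n, |r k - M k| ≤ L * √(M n))
    (hreg : ∀ k ≤ n, |M k - ((k : ℝ) / n) ^ θ * M n| ≤ d * √(M n))
    (hinc : ∀ k < n, |r (k + 1) - r k| ≤ 1) {t : ℝ} (ht : t ∈ Set.Icc (0 : ℝ) 1) :
    |interpolate n (fun k => (r k - ((k : ℝ) / n) ^ θ * r n) / √(r n)) t -
      ((r ⌊(n : ℝ) * t⌋₊ - M ⌊(n : ℝ) * t⌋₊) / √(M n) - t ^ θ * ((r n - M n) / √(M n)))| ≤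
    (2 * L + d) * (2 * L) / √(M n) + d + 2 / √(M n) + 2 * (1 / (n : ℝ)) ^ θ * √(M n) +
      (1 / (n : ℝ)) ^ θ * L := by
  obtain ⟨ht0, ht1⟩ := ht
  have hn0 : (0 : ℝ) < n := by exact_mod_cast hn
  set S := √(M n) with hS
  have hS0 : 0 < S := Real.sqrt_pos.2 hM
  have hS2 : S ^ 2 = M n := Real.sq_sqrt hM.le
  set w := (1 / (n : ℝ)) ^ θ with hw
  have hw0 : 0 ≤ w := by positivity
  have hdn := abs_le.1 (hdev n le_rfl)
  have hLS : L * S ≤ 3 / 4 * S ^ 2 := by nlinarith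
  have hrlo : S ^ 2 / 4 ≤ r n := by linarith
  have hrup : r n ≤ 2 * S ^ 2 := by nlinarith
  have hr0 : 0 < r n := lt_of_lt_of_le (by positivity) hrlo
  set Q := √(r n) with hQ
  have hQ0 : 0 < Q := Real.sqrt_pos.2 hr0
  have hQ2 : Q ^ 2 = r n := Real.sq_sqrt hr0.le
  have hQlo : S / 2 ≤ Q := by
    refine abs_le_of_sq_le_sq' ?_ hQ0.le |>.2
    nlinarith
  have hQup : Q ≤ 2 * S := by
    refine abs_le_of_sq_le_sq' ?_ (by positivity) |>.2
    nlinarith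
  have hSQ : |S - Q| ≤ L := by
    have h1 : |S - Q| * (S + Q) ≤ L * S := by
      rw [← abs_of_nonneg (show 0 ≤ S + Q by positivity), ← abs_mul,
        show (S - Q) * (S + Q) = -(r n - M n) by rw [← hQ2, ← hS2]; ring, abs_neg]
      exact hdev n le_rfl
    have h2 : |S - Q| * S ≤ L * S := by nlinarith [abs_nonneg (S - Q)]
    exact le_of_mul_le_mul_right h2 hS0
  have hQi : 1 / Q ≤ 2 / S := by
    rw [div_le_div_iff₀ hQ0 hS0]; linarith
  have hrecip : |1 / Q - 1 / S| ≤ 2 * L / S ^ 2 := by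
    have e : 1 / Q - 1 / S = (S - Q) * (1 / Q) / S := by field_simp
    rw [e, abs_div, abs_mul, abs_of_pos hS0, abs_of_pos (show 0 < 1 / Q by positivity)]
    calc |S - Q| * (1 / Q) / S ≤ L * (2 / S) / S := by gcongr
      _ = 2 * L / S ^ 2 := by field_simp
  set k := ⌊(n : ℝ) * t⌋₊ with hk
  have hkle : (k : ℝ) ≤ n * t := Nat.floor_le (by positivity)
  have hklt : n * t < (k : ℝ) + 1 := Nat.lt_floor_add_one _
  have hkn : k ≤ n := by
    have : (k : ℝ) ≤ n := hkle.trans (mul_le_of_le_one_right hn0.le ht1)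
    exact_mod_cast this
  set τ := (k : ℝ) / n with hτ
  have hτ0 : 0 ≤ τ := by positivity
  have hτt : τ ≤ t := by rw [hτ, div_le_iff₀ hn0]; linarith
  have htτ : t ≤ τ + 1 / n := by rw [hτ, ← add_div, le_div_iff₀ hn0]; linarith
  have hτ1 : τ ^ θ ≤ 1 := Real.rpow_le_one hτ0 (hτt.trans ht1) hθ0.le
  have hτθ : 0 ≤ τ ^ θ := by positivity
  have hpow : |t ^ θ - τ ^ θ| ≤ w := abs_rpow_sub_rpow_le hθ0 hθ1 hτ0 hτt htτ
  set v : ℕ → ℝ := fun j => (r j - ((j : ℝ) / n) ^ θ * r n) / Q with hv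
  -- the change of normalisation at the node to the left of `t`
  have hA : |r k - τ ^ θ * r n| ≤ (2 * L + d) * S := by
    have e : r k - τ ^ θ * r n = (r k - M k) + (M k - τ ^ θ * M n) - τ ^ θ * (r n - M n) := by ring
    rw [e]
    have h3 : |τ ^ θ * (r n - M n)| ≤ 1 * (L * S) := by
      rw [abs_mul, abs_of_nonneg hτθ]
      exact mul_le_mul hτ1 (hdev n le_rfl) (abs_nonneg _) zero_le_one
    have h4 := abs_sub ((r k - M k) + (M k - τ ^ θ * M n)) (τ ^ θ * (r n - M n))
    have h5 := abs_add_le (r k - M k) (M k - τ ^ θ * M n)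
    linarith [hdev k hkn, hreg k hkn]
  have hT1 : |(r k - τ ^ θ * r n) * (1 / Q - 1 / S)| ≤ (2 * L + d) * (2 * L) / S := by
    rw [abs_mul]
    refine (mul_le_mul hA hrecip (abs_nonneg _) (by positivity)).trans (le_of_eq ?_)
    field_simp
  have hT2 : |(M k - τ ^ θ * M n) / S| ≤ d := by
    rw [abs_div, abs_of_pos hS0, div_le_iff₀ hS0]
    exact hreg k hkn
  -- the increment of the interpolation
  have hT3 : |n * (t - τ) * (v (k + 1) - v k)| ≤ 2 / S + 2 * w * S := by
    have hu0 : 0 ≤ n * (t - τ) := mul_nonneg hn0.le (by linarith)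
    rcases hkn.lt_or_eq with hlt | heq
    · have hu1 : n * (t - τ) ≤ 1 := by
        calc n * (t - τ) ≤ n * (1 / n) := by gcongr; linarith
          _ = 1 := by field_simp
      have hp2 : |(((k + 1 : ℕ) : ℝ) / n) ^ θ - τ ^ θ| ≤ w := by
        refine abs_rpow_sub_rpow_le hθ0 hθ1 hτ0 ?_ ?_
        · rw [hτ]; gcongr; simp
        · rw [hτ, ← add_div]; push_cast; exact le_rfl
      have e : v (k + 1) - v k =
          (r (k + 1) - r k) * (1 / Q) - ((((k + 1 : ℕ) : ℝ) / n) ^ θ - τ ^ θ) * Q := by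
        simp only [hv, ← hτ]
        rw [← hQ2]
        field_simp
        ring
      have h1 : |(r (k + 1) - r k) * (1 / Q)| ≤ 1 * (2 / S) := by
        rw [abs_mul, abs_of_pos (show 0 < 1 / Q by positivity)]
        exact mul_le_mul (hinc k hlt) hQi (by positivity) zero_le_one
      have h2 : |((((k + 1 : ℕ) : ℝ) / n) ^ θ - τ ^ θ) * Q| ≤ w * (2 * S) := by
        rw [abs_mul, abs_of_pos hQ0]
        exact mul_le_mul hp2 hQup hQ0.le hw0
      have h3 : |v (k + 1) - v k| ≤ 2 / S + 2 * w * S := by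
        rw [e]
        have := abs_sub ((r (k + 1) - r k) * (1 / Q)) (((((k + 1 : ℕ) : ℝ) / n) ^ θ - τ ^ θ) * Q)
        linarith
      rw [abs_mul, abs_of_nonneg hu0]
      exact (mul_le_of_le_one_left (abs_nonneg _) hu1).trans h3
    · -- here `t = 1` and the interpolation coefficient vanishes
      have hτ' : τ = 1 := by rw [hτ, heq]; field_simp
      have : t - τ = 0 := by linarith
      rw [this, mul_zero, zero_mul, abs_zero]
      positivity
  have hT4 : |(t ^ θ - τ ^ θ) * ((r n - M n) / S)| ≤ w * L := by
    rw [abs_mul, abs_div, abs_of_pos hS0]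
    refine mul_le_mul hpow ?_ (by positivity) hw0
    rw [div_le_iff₀ hS0]
    exact hdev n le_rfl
  have e : interpolate n v t - ((r k - M k) / S - t ^ θ * ((r n - M n) / S)) =
      (r k - τ ^ θ * r n) * (1 / Q - 1 / S) + (M k - τ ^ θ * M n) / S +
        n * (t - τ) * (v (k + 1) - v k) + (t ^ θ - τ ^ θ) * ((r n - M n) / S) := by
    have : interpolate n v t = (r k - τ ^ θ * r n) / Q + n * (t - τ) * (v (k + 1) - v k) := rfl
    rw [this]
    field_simp
    ring
  rw [e]
  have b1 := abs_add_le ((r k - τ ^ θ * r n) * (1 / Q - 1 / S) + (M k - τ ^ θ * M n) / S +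
        n * (t - τ) * (v (k + 1) - v k)) ((t ^ θ - τ ^ θ) * ((r n - M n) / S))
  have b2 := abs_add_le ((r k - τ ^ θ * r n) * (1 / Q - 1 / S) + (M k - τ ^ θ * M n) / S)
        (n * (t - τ) * (v (k + 1) - v k))
  have b3 := abs_add_le ((r k - τ ^ θ * r n) * (1 / Q - 1 / S)) ((M k - τ ^ θ * M n) / S)
  linarith

section Asymptotic

variable {M : ℕ → ℝ} {C θ : ℝ}

lemma isBigO_rpow_half (hθ0 : 0 < θ) :
    (fun n : ℕ => (n : ℝ) ^ (θ / 2)) =O[atTop] fun n : ℕ => (n : ℝ) ^ θ := by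
  refine IsBigO.of_bound 1 ?_
  filter_upwards [eventually_ge_atTop 1] with n hn
  rw [one_mul, Real.norm_of_nonneg (by positivity), Real.norm_of_nonneg (by positivity)]
  exact Real.rpow_le_rpow_of_exponent_le (by exact_mod_cast hn) (by linarith)

lemma eventually_between (hC : 0 < C) (hθ0 : 0 < θ)
    (hM : (fun n : ℕ => M n - C * (n : ℝ) ^ θ) =o[atTop] fun n : ℕ => (n : ℝ) ^ (θ / 2)) :
    ∀ᶠ n : ℕ in atTop, C / 2 * (n : ℝ) ^ θ ≤ M n ∧ M n ≤ 2 * C * (n : ℝ) ^ θ := by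
  filter_upwards [isLittleO_iff.1 (hM.trans_isBigO (isBigO_rpow_half hθ0)) (half_pos hC)] with n hn
  rw [Real.norm_eq_abs, Real.norm_eq_abs,
    abs_of_nonneg (show (0 : ℝ) ≤ (n : ℝ) ^ θ by positivity)] at hn
  have h := abs_le.1 hn
  have h0 : 0 ≤ C * (n : ℝ) ^ θ := by positivity
  constructor <;> linarith

/-- A mean that is regular up to `o(n ^ (θ / 2))` is close to its power-law rescaling, uniformly
over all earlier times. -/
lemma eventually_regular (hC : 0 < C) (hθ0 : 0 < θ)
    (hM : (fun n : ℕ => M n - C * (n : ℝ) ^ θ) =o[atTop] fun n : ℕ => (n : ℝ) ^ (θ / 2))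
    {η : ℝ} (hη : 0 < η) :
    ∀ᶠ n : ℕ in atTop, ∀ k ≤ n, |M k - ((k : ℝ) / n) ^ θ * M n| ≤ η * √(M n) := by
  set e : ℕ → ℝ := fun n => M n - C * (n : ℝ) ^ θ with he
  set a := √(C / 2) with ha
  have ha0 : 0 < a := Real.sqrt_pos.2 (by linarith)
  have hδ : 0 < η * a / 4 := by positivity
  obtain ⟨N, hN⟩ := eventually_atTop.1 (isLittleO_iff.1 hM hδ)
  set K := ∑ k ∈ Finset.range N, |e k| with hK
  have hgrow : Tendsto (fun n : ℕ => η * a / 4 * (n : ℝ) ^ (θ / 2)) atTop atTop :=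
    ((tendsto_rpow_atTop (by linarith : 0 < θ / 2)).comp
      tendsto_natCast_atTop_atTop).const_mul_atTop hδ
  filter_upwards [eventually_between hC hθ0 hM, hgrow.eventually_ge_atTop K,
    eventually_ge_atTop 1] with n hb hKn hn k hk
  have hn0 : (0 : ℝ) < n := by exact_mod_cast hn
  have hsmall : ∀ j ≤ n, |e j| ≤ η * a / 2 * (n : ℝ) ^ (θ / 2) := by
    intro j hj
    have hp : (0 : ℝ) ≤ η * a / 4 * (n : ℝ) ^ (θ / 2) := by positivity
    rcases lt_or_ge j N with h | h
    · have : |e j| ≤ K := Finset.single_le_sum (f := fun j => |e j|) (fun _ _ => abs_nonneg _)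
        (Finset.mem_range.2 h)
      linarith
    · have h1 := hN j h
      rw [Real.norm_eq_abs, Real.norm_eq_abs,
        abs_of_nonneg (show (0 : ℝ) ≤ (j : ℝ) ^ (θ / 2) by positivity)] at h1
      have h2 : (j : ℝ) ^ (θ / 2) ≤ (n : ℝ) ^ (θ / 2) :=
        Real.rpow_le_rpow (by positivity) (by exact_mod_cast hj) (by linarith)
      have h3 := mul_le_mul_of_nonneg_left h2 hδ.le
      change |e j| ≤ _ at h1
      linarith
  have hsqrt : a * (n : ℝ) ^ (θ / 2) ≤ √(M n) := by
    refine Real.le_sqrt_of_sq_le ?_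
    rw [mul_pow, ha, Real.sq_sqrt (by linarith), ← Real.rpow_natCast, ← Real.rpow_mul hn0.le]
    simpa using hb.1
  have hq0 : 0 ≤ (k : ℝ) / n := by positivity
  have hq1 : ((k : ℝ) / n) ^ θ ≤ 1 := Real.rpow_le_one hq0
    (div_le_one_of_le₀ (by exact_mod_cast hk) hn0.le) hθ0.le
  have hkn : ((k : ℝ) / n) ^ θ * (n : ℝ) ^ θ = (k : ℝ) ^ θ := by
    rw [← Real.mul_rpow hq0 hn0.le, div_mul_cancel₀ _ hn0.ne']
  have e1 : M k - ((k : ℝ) / n) ^ θ * M n = e k - ((k : ℝ) / n) ^ θ * e n := by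
    simp only [he]
    rw [← hkn]
    ring
  rw [e1]
  have h1 : |((k : ℝ) / n) ^ θ * e n| ≤ |e n| := by
    rw [abs_mul, abs_of_nonneg (Real.rpow_nonneg hq0 θ)]
    exact mul_le_of_le_one_left (abs_nonneg _) hq1
  have h2 := abs_sub (e k) (((k : ℝ) / n) ^ θ * e n)
  have h3 := mul_le_mul_of_nonneg_left hsqrt hη.le
  linarith [hsmall k hk, hsmall n le_rfl]

/-- Uniform comparison of the bridges over all paths that stay within `4 log n √(M n)` of the
mean. -/
lemma eventually_abs_bridge_sub_le (hC : 0 < C) (hθ0 : 0 < θ) (hθ1 : θ < 1)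
    (hM : (fun n : ℕ => M n - C * (n : ℝ) ^ θ) =o[atTop] fun n : ℕ => (n : ℝ) ^ (θ / 2))
    {ε : ℝ} (hε : 0 < ε) :
    ∀ᶠ n : ℕ in atTop, ∀ r : ℕ → ℝ, (∀ k ≤ n, |r k - M k| ≤ 4 * Real.log n * √(M n)) →
      (∀ k < n, |r (k + 1) - r k| ≤ 1) → ∀ t ∈ Set.Icc (0 : ℝ) 1,
      |interpolate n (fun k => (r k - ((k : ℝ) / n) ^ θ * r n) / √(r n)) t -
        ((r ⌊(n : ℝ) * t⌋₊ - M ⌊(n : ℝ) * t⌋₊) / √(M n) - t ^ θ * ((r n - M n) / √(M n)))|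
      ≤ ε := by
  set a := √(C / 2) with ha
  have ha0 : 0 < a := Real.sqrt_pos.2 (by linarith)
  set b := √(2 * C) with hb
  have hb0 : 0 < b := Real.sqrt_pos.2 (by linarith)
  set d := min (ε / 2) 1 with hd
  have hd0 : 0 < d := lt_min (by linarith) one_pos
  -- All quantities are compared with powers of `y = n ^ (θ / 8)`.
  have hy : Tendsto (fun n : ℕ => (n : ℝ) ^ (θ / 8)) atTop atTop :=
    (tendsto_rpow_atTop (by linarith : 0 < θ / 8)).comp tendsto_natCast_atTop_atTop
  have hlog : ∀ᶠ n : ℕ in atTop, ‖Real.log n‖ ≤ 1 * ‖(n : ℝ) ^ (θ / 8)‖ :=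
    tendsto_natCast_atTop_atTop.eventually
      (isLittleO_iff.1 (isLittleO_log_rpow_atTop (by linarith : 0 < θ / 8)) one_pos)
  filter_upwards [eventually_between hC hθ0 hM, eventually_regular hC hθ0 hM hd0, hlog,
    hy.eventually_ge_atTop 1, hy.eventually_ge_atTop (16 / (3 * a)),
    hy.eventually_ge_atTop ((74 / a + 2 * b + 4) * (2 / ε)), eventually_ge_atTop 1]
    with n hbet hreg hlog hy1 hya hyε hn r hdev hinc t ht
  have hn0 : (0 : ℝ) < n := by exact_mod_cast hn
  set y := (n : ℝ) ^ (θ / 8) with hydef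
  have hy0 : 0 < y := by linarith
  have hl0 : 0 ≤ Real.log n := Real.log_natCast_nonneg n
  have hly : Real.log n ≤ y := by
    rw [one_mul, Real.norm_eq_abs, Real.norm_eq_abs, abs_of_nonneg hl0, abs_of_pos hy0] at hlog
    exact hlog
  have hy8 : (n : ℝ) ^ θ = (y ^ 4) ^ 2 := by
    rw [hydef, ← pow_mul, ← Real.rpow_natCast, ← Real.rpow_mul hn0.le]
    congr 1; push_cast; ring
  have hw : (1 / (n : ℝ)) ^ θ = 1 / (y ^ 4) ^ 2 := by
    rw [Real.div_rpow zero_le_one hn0.le, Real.one_rpow, hy8]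
  rw [hy8] at hbet
  have hSlo : a * y ^ 4 ≤ √(M n) := by
    refine Real.le_sqrt_of_sq_le ?_
    rw [mul_pow, ha, Real.sq_sqrt (by linarith)]
    exact hbet.1
  have hSup : √(M n) ≤ b * y ^ 4 := by
    refine Real.sqrt_le_iff.2 ⟨by positivity, ?_⟩
    rw [mul_pow, hb, Real.sq_sqrt (by linarith)]
    exact hbet.2
  have hS0 : 0 < √(M n) := lt_of_lt_of_le (by positivity) hSlo
  have hMn : 0 < M n := Real.sqrt_pos.1 hS0
  have hLM : 4 * Real.log n ≤ 3 / 4 * √(M n) := by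
    rw [div_le_iff₀ (by positivity)] at hya
    have h1 : y * y ≤ y ^ 4 := by
      calc y * y = y ^ 2 := by ring
        _ ≤ y ^ 4 := pow_le_pow_right₀ hy1 (by norm_num)
    have h2 : 16 * y ≤ 3 * (a * y ^ 4) := by nlinarith
    linarith
  refine (abs_bridge_sub_le hθ0 hθ1 hn (by positivity) hd0.le hMn hLM hdev hreg hinc ht).trans ?_
  rw [hw]
  have hdε : d ≤ ε / 2 := min_le_left _ _
  have hd1 : d ≤ 1 := min_le_right _ _
  have hay : 0 < a * y ^ 4 := by positivity
  have c1 : (2 * (4 * Real.log n) + d) * (2 * (4 * Real.log n)) / √(M n) ≤ 72 / a / y := by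
    calc (2 * (4 * Real.log n) + d) * (2 * (4 * Real.log n)) / √(M n)
        ≤ (2 * (4 * y) + y) * (2 * (4 * y)) / (a * y ^ 4) := by
          have := hd1.trans hy1
          gcongr
      _ = 72 / a / y * (1 / y) := by field_simp; ring
      _ ≤ 72 / a / y := mul_le_of_le_one_right (by positivity) (div_le_one_of_le₀ hy1 hy0.le)
  have c2 : 2 / √(M n) ≤ 2 / a / y := by
    calc 2 / √(M n) ≤ 2 / (a * y ^ 4) := by gcongr
      _ ≤ 2 / (a * y) := by
          gcongr
          exact le_self_pow₀ hy1 (by norm_num)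
      _ = 2 / a / y := by field_simp
  have c3 : 2 * (1 / (y ^ 4) ^ 2) * √(M n) ≤ 2 * b / y := by
    calc 2 * (1 / (y ^ 4) ^ 2) * √(M n) ≤ 2 * (1 / (y ^ 4) ^ 2) * (b * y ^ 4) := by gcongr
      _ = 2 * b / y ^ 4 := by field_simp
      _ ≤ 2 * b / y := by
          gcongr
          exact le_self_pow₀ hy1 (by norm_num)
  have c4 : 1 / (y ^ 4) ^ 2 * (4 * Real.log n) ≤ 4 / y := by
    calc 1 / (y ^ 4) ^ 2 * (4 * Real.log n) ≤ 1 / (y ^ 4) ^ 2 * (4 * y) := by gcongr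
      _ = 4 / y ^ 7 := by field_simp
      _ ≤ 4 / y := by
          gcongr
          exact le_self_pow₀ hy1 (by norm_num)
  have c5 : (74 / a + 2 * b + 4) / y ≤ ε / 2 := by
    rw [div_le_iff₀ hy0]
    calc 74 / a + 2 * b + 4 = ε / 2 * ((74 / a + 2 * b + 4) * (2 / ε)) := by field_simp
      _ ≤ ε / 2 * y := by gcongr
  have c6 : 72 / a / y + 2 / a / y + 2 * b / y + 4 / y = (74 / a + 2 * b + 4) / y := by
    field_simp; ring
  linarith

end Asymptotic

section Paths

variable {Ω : Type*} (X : ℕ → Ω → ℕ)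

lemma abs_card_insert_sub_le (s : Finset ℕ) (x : ℕ) :
    |((insert x s).card : ℝ) - s.card| ≤ 1 := by
  have h1 : ((insert x s).card : ℝ) ≤ s.card + 1 := by exact_mod_cast Finset.card_insert_le x s
  have h2 : (s.card : ℝ) ≤ (insert x s).card := by
    exact_mod_cast Finset.card_le_card (Finset.subset_insert x s)
  exact abs_le.2 ⟨by linarith, by linarith⟩

lemma abs_fwd_succ_sub_le (k : ℕ) (ω : Ω) : |(fwd X (k + 1) ω : ℝ) - fwd X k ω| ≤ 1 := by
  change |((seen X (k + 1) ω).card : ℝ) - (seen X k ω).card| ≤ 1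
  rw [seen_succ]
  exact abs_card_insert_sub_le _ _

lemma abs_bwd_succ_sub_le {n k : ℕ} (hk : k < n) (ω : Ω) :
    |(bwd X n (k + 1) ω : ℝ) - bwd X n k ω| ≤ 1 := by
  have h : Finset.Ico (n - (k + 1)) n = insert (n - (k + 1)) (Finset.Ico (n - k) n) := by
    ext i
    simp only [Finset.mem_insert, Finset.mem_Ico]
    omega
  unfold bwd
  rw [h, Finset.image_insert]
  exact abs_card_insert_sub_le _ _

lemma bwd_self (n : ℕ) (ω : Ω) : bwd X n n ω = fwd X n ω := by
  rw [bwd_eq_fwd X le_rfl]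
  simp

end Paths

lemma tendsto_iSup_ofReal_abs {F : ℕ → ℝ → ℝ}
    (h : ∀ ε : ℝ, 0 < ε → ∀ᶠ n in atTop, ∀ t ∈ Set.Icc (0 : ℝ) 1, |F n t| ≤ ε) :
    Tendsto (fun n : ℕ => ⨆ t ∈ Set.Icc (0 : ℝ) 1, ENNReal.ofReal |F n t|) atTop (𝓝 0) := by
  rw [ENNReal.tendsto_nhds_zero]
  intro ε hε
  obtain ⟨δ, hδ0, hδ⟩ := ENNReal.lt_iff_exists_real_btwn.1 hε
  have hδ1 : 0 < δ := ENNReal.ofReal_pos.1 hδ.1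
  filter_upwards [h δ hδ1] with n hn
  exact iSup₂_le fun t ht => (ENNReal.ofReal_le_ofReal (hn t ht)).trans hδ.2.le

end UrnScheme

open UrnScheme in
theorem theorem4 {Ω : Type*} [MeasurableSpace Ω] (μ : Measure Ω) [IsProbabilityMeasure μ]
    (X : ℕ → Ω → ℕ) (hX_meas : ∀ n, Measurable (X n)) (hX_pos : ∀ n ω, 1 ≤ X n ω)
    (hX_indep : iIndepFun X μ)
    (p : ℕ → ℝ) (hX_law : ∀ n i, 1 ≤ i → μ.real {ω | X n ω = i} = p i)
    (c θ : ℝ) (hc : 0 < c) (hθ0 : 0 < θ) (hθ1 : θ < 1) (hp : UrnScheme.PowerDecay p c θ) :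
    (∀ᵐ ω ∂μ, Tendsto
      (fun n : ℕ => ⨆ t ∈ Set.Icc (0 : ℝ) 1,
        ENNReal.ofReal |UrnScheme.bridge X θ n t ω -
          (UrnScheme.Z μ X n t ω - t ^ θ * UrnScheme.Z μ X n 1 ω)|)
      atTop (𝓝 0)) ∧
    (∀ᵐ ω ∂μ, Tendsto
      (fun n : ℕ => ⨆ t ∈ Set.Icc (0 : ℝ) 1,
        ENNReal.ofReal |UrnScheme.bridge' X θ n t ω -
          (UrnScheme.Z' μ X n t ω - t ^ θ * UrnScheme.Z' μ X n 1 ω)|)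
      atTop (𝓝 0)) := by
  set ν : Measure ℕ := μ.map (X 0) with hν
  have : IsProbabilityMeasure ν := Measure.isProbabilityMeasure_map (hX_meas 0).aemeasurable
  have hreal : ∀ n i, (μ.map (X n)).real {i} = if i = 0 then 0 else p i := by
    intro n i
    rw [map_measureReal_apply (hX_meas n) (measurableSet_singleton i)]
    split_ifs with hi
    · have : X n ⁻¹' {i} = ∅ := by
        ext ω
        have := hX_pos n ω
        simp only [Set.mem_preimage, Set.mem_singleton_iff, Set.mem_empty_iff_false, iff_false]
        omega
      rw [this, measureReal_empty]
    · exact hX_law n i (Nat.one_le_iff_ne_zero.2 hi)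
  have hlaw : ∀ n, μ.map (X n) = ν := by
    intro n
    have := Measure.isProbabilityMeasure_map (μ := μ) (hX_meas n).aemeasurable
    refine Measure.ext_of_singleton fun i => ?_
    rw [← measureReal_eq_measureReal_iff, hreal, hν, hreal]
  have hmean : ∀ k, meanFwd μ X k = meanDistinct ν k := meanFwd_eq hX_meas hX_indep hlaw
  have hdecay : PowerDecay (fun i => ν.real {i}) c θ := by
    obtain ⟨ε, hε, h⟩ := hp
    exact ⟨ε, hε, fun i hi =>
      ((hreal 0 i).trans (if_neg (by omega))).trans (h i hi)⟩
  obtain ⟨C, hC, hM⟩ := meanDistinct_asymptotic (by rw [hν, hreal, if_pos rfl]) hc hθ0 hθ1 hdecay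
  have hdev := ae_eventually_window_deviation_le hX_meas hX_indep hlaw
  constructor
  · filter_upwards [hdev] with ω hω
    refine tendsto_iSup_ofReal_abs fun ε hε => ?_
    filter_upwards [hω, eventually_abs_bridge_sub_le hC hθ0 hθ1 hM hε] with n hn hb t ht
    have h := hb (fun k => (fwd X k ω : ℝ)) (fun k hk => (hn k hk).1)
      (fun k _ => abs_fwd_succ_sub_le X k ω) t ht
    simpa only [bridge, bridgeNode, Z, hmean, mul_one, Nat.floor_natCast] using h
  · filter_upwards [hdev] with ω hω
    refine tendsto_iSup_ofReal_abs fun ε hε => ?_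
    filter_upwards [hω, eventually_abs_bridge_sub_le hC hθ0 hθ1 hM hε] with n hn hb t ht
    have h := hb (fun k => (bwd X n k ω : ℝ)) (fun k hk => (hn k hk).2)
      (fun k hk => abs_bwd_succ_sub_le X hk ω) t ht
    simpa only [bridge', bridgeNode', Z', hmean, mul_one, Nat.floor_natCast, bwd_self] using h
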